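/- Let $\sigma,\gamma>0$, $0<\pi_G<1$ and $\pi_C=1-\pi_G$. Given an observation vector $\mathbf{Y}\in\mathbb{R}^n$, consider the test between the hypothesis $H_G$ (prior probability $\pi_G$) that the $n$ observations are i.i.d. Gaussian $\mathcal{N}(0,\sigma^2)$, i.e. $\mathbf{Y}$ has density $$p_G(y)=\frac{1}{(2\pi\sigma^2)^{n/2}}\,e^{-\|y\|^2/(2\sigma^2)},$$ and the hypothesis $H_C$ (prior probability $\pi_C$) that $\mathbf{Y}$ is isotropic Cauchy $\mathcal{C}(0,\gamma)$, i.e. has density $$p_C(y)=\frac{\Gamma\left(\frac{n+1}{2}\right)}{\pi^{\frac{n+1}{2}}\,\gamma^n}\,\frac{1}{\left(1+\|y\|^2/\gamma^2\right)^{\frac{n+1}{2}}}.$$ Let $\xi=\sqrt2\,\sigma/\gamma$, $\tilde\eta=\pi_C/\pi_G$ and $$C=\left(\frac{1}{\tilde\eta}\,\frac{\xi}{2}\right)^{2}e^{2/\xi^2}.$$ The MAP detector decides $H_G$ when $\pi_G\,p_G(y)\ge\pi_C\,p_C(y)$ and $H_C$ otherwise. Write $P_F=\Pr(\text{decide }H_C\mid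 H_G)$, $P_D=\Pr(\text{decide }H_C\mid H_C)$ and $P_e=\pi_G P_F+\pi_C(1-P_D)$. For every $n$ the MAP detector minimizes $P_e$ among all (measurable, deterministic) detectors, and, as $n\to\infty$, its error probabilities satisfy $$1-P_D\sim\sqrt{\frac2\pi}\,\frac1{\tilde\eta}\,\sqrt{\frac{\ln(Cn)}{Cn}},\qquad P_F\sim\sqrt{\frac2\pi}\,\frac{1}{\sqrt{Cn\,\ln(Cn)}},\qquad P_e\sim\sqrt{\frac2\pi}\,\frac{\pi_C}{\tilde\eta}\,\sqrt{\frac{\ln(Cn)}{Cn}},$$ where $f\sim g$ means $f(n)/g(n)\to1$. In particular the two error types decay at different rates: $P_F=o(1-P_D)$. -/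

import Mathlib

open MeasureTheory ProbabilityTheory Filter Asymptotics

namespace CauchyTest

/-- Density on `ℝⁿ` of `n` independent `𝒩(0, σ²)` observations:
`(2 π σ²) ^ (-n/2) * exp (-‖y‖² / (2 σ²))`, a product of one-dimensional normal densities. -/
noncomputable def gaussianDensity (n : ℕ) (σ : ℝ) (y : EuclideanSpace ℝ (Fin n)) : ℝ :=
  ∏ i, gaussianPDFReal 0 (σ ^ 2).toNNReal (y i)

/-- Density on `ℝⁿ` of the isotropic Cauchy law `𝒞(0, γ)`:
`γ⁻ⁿ Γ((n+1)/2) π ^ (-(n+1)/2) (1 + ‖y/γ‖²) ^ (-(n+1)/2)`. -/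
noncomputable def cauchyDensity (n : ℕ) (γ : ℝ) (y : EuclideanSpace ℝ (Fin n)) : ℝ :=
  Real.Gamma (((n : ℝ) + 1) / 2) /
    (Real.pi ^ (((n : ℝ) + 1) / 2) * γ ^ n * (1 + ‖y‖ ^ 2 / γ ^ 2) ^ (((n : ℝ) + 1) / 2))

/-- Law of the observations under the Gaussian hypothesis. -/
noncomputable def gaussianLaw (n : ℕ) (σ : ℝ) : Measure (EuclideanSpace ℝ (Fin n)) :=
  volume.withDensity fun y => ENNReal.ofReal (gaussianDensity n σ y)

/-- Law of the observations under the Cauchy hypothesis. -/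
noncomputable def cauchyLaw (n : ℕ) (γ : ℝ) : Measure (EuclideanSpace ℝ (Fin n)) :=
  volume.withDensity fun y => ENNReal.ofReal (cauchyDensity n γ y)

/-- A (deterministic) detector is given by the set `A` of observations on which it decides for the
Gaussian hypothesis; on `Aᶜ` it decides for the Cauchy hypothesis. The false alarm probability
`P_F` is the probability of deciding for Cauchy under the Gaussian hypothesis. -/
noncomputable def falseAlarm (n : ℕ) (σ : ℝ) (A : Set (EuclideanSpace ℝ (Fin n))) : ℝ :=
  (gaussianLaw n σ).real Aᶜ

/-- The detection probability `P_D` of the detector `A`: the probability of deciding for Cauchy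
under the Cauchy hypothesis. -/
noncomputable def detection (n : ℕ) (γ : ℝ) (A : Set (EuclideanSpace ℝ (Fin n))) : ℝ :=
  (cauchyLaw n γ).real Aᶜ

/-- Bayesian error probability `P_e = π_G P_F + π_C (1 - P_D)` of the detector `A`. -/
noncomputable def errorProb (n : ℕ) (σ γ priorG priorC : ℝ)
    (A : Set (EuclideanSpace ℝ (Fin n))) : ℝ :=
  priorG * falseAlarm n σ A + priorC * (1 - detection n γ A)

/-- The MAP detector: decide for Gaussian when the posterior weight of the Gaussian hypothesis is
at least that of the Cauchy hypothesis, i.e. when `p_G(y) / p_C(y) ≥ π_C / π_G`. -/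
def mapRegion (n : ℕ) (σ γ priorG priorC : ℝ) : Set (EuclideanSpace ℝ (Fin n)) :=
  {y | priorC * cauchyDensity n γ y ≤ priorG * gaussianDensity n σ y}

end CauchyTest

/-! ### Radial densities and their integrability -/

namespace CauchyTest

/-! Both densities depend only on `‖y‖`, so in the coordinate v = log(‖y‖²/(nσ²)) the test becomes
one between two densities on the line, g_n (Gaussian) and c_n (Cauchy). Write τ_n = `logScale n` =
√(2 log n / n), ρ = σ²/γ², and c = `cauchyLimit ρ`.

Near v = 0, where g_n peaks, c_n is essentially flat: c_n(v_n) → c whenever v_n → 0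
(`tendsto_cauchyLogDensity`). On the other side g_n(v) is its peak, of order √n by Stirling, times
exp(n/2 · (v + 1 - e^v)), which is roughly exp(-nv²/4). At v = θτ_n the log-likelihood ratio is
therefore about (1 - θ²)/2 · log n (`tendsto_logLikelihood`). Since the acceptance region is an
interval (`ordConnected_logRegion`), its endpoints are asymptotic to ±τ_n
(`exists_logRegion_endpoints`).

A missed detection integrates the flat c_n over a length close to 2τ_n, giving 2cτ_n. For a false
alarm, the endpoints satisfy g_n = η c_n → ηc, so the height of g_n there is known without refining
their position; beyond them g_n decays exponentially at rate about nτ_n/2, and the two tails total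
4ηc/(nτ_n) (`tendsto_gaussianLogDensity_tail`). The quotient of the two errors is of order 1/(nτ_n²)
= 1/(2 log n), so misses dominate the Bayesian error. The constant C is the one for which 2√π · η ·
√C · c = 1. -/

/-- Radial profile of the Gaussian density. -/
noncomputable def gaussianProfile (n : ℕ) (σ r : ℝ) : ℝ :=
  (√(2 * Real.pi * σ ^ 2))⁻¹ ^ n * Real.exp (-r ^ 2 / (2 * σ ^ 2))

/-- Radial profile of the Cauchy density. -/
noncomputable def cauchyProfile (n : ℕ) (γ r : ℝ) : ℝ :=
  Real.Gamma (((n : ℝ) + 1) / 2) /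
    (Real.pi ^ (((n : ℝ) + 1) / 2) * γ ^ n * (1 + r ^ 2 / γ ^ 2) ^ (((n : ℝ) + 1) / 2))

theorem gaussianDensity_eq_profile (n : ℕ) (σ : ℝ) (y : EuclideanSpace ℝ (Fin n)) :
    gaussianDensity n σ y = gaussianProfile n σ ‖y‖ := by
  simp only [gaussianDensity, gaussianProfile, gaussianPDFReal, Finset.prod_mul_distrib,
    Finset.prod_const, Finset.card_univ, Fintype.card_fin, Real.coe_toNNReal _ (sq_nonneg σ),
    sub_zero, ← Real.exp_sum]
  rw [EuclideanSpace.real_norm_sq_eq, ← Finset.sum_div, Finset.sum_neg_distrib]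

theorem cauchyDensity_eq_profile (n : ℕ) (γ : ℝ) (y : EuclideanSpace ℝ (Fin n)) :
    cauchyDensity n γ y = cauchyProfile n γ ‖y‖ := rfl

theorem gaussianDensity_nonneg (n : ℕ) (σ : ℝ) (y : EuclideanSpace ℝ (Fin n)) :
    0 ≤ gaussianDensity n σ y := by
  rw [gaussianDensity_eq_profile, gaussianProfile]; positivity

theorem cauchyDensity_nonneg (n : ℕ) {γ : ℝ} (hγ : 0 < γ) (y : EuclideanSpace ℝ (Fin n)) :
    0 ≤ cauchyDensity n γ y := by
  rw [cauchyDensity]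
  have := Real.Gamma_pos_of_pos (show 0 < ((n : ℝ) + 1) / 2 by positivity)
  positivity

theorem continuous_gaussianDensity (n : ℕ) (σ : ℝ) : Continuous (gaussianDensity n σ) := by
  have : gaussianDensity n σ = fun y => gaussianProfile n σ ‖y‖ :=
    funext (gaussianDensity_eq_profile n σ)
  rw [this]
  unfold gaussianProfile
  fun_prop

theorem continuous_cauchyDensity (n : ℕ) {γ : ℝ} (hγ : 0 < γ) :
    Continuous (cauchyDensity n γ) := by
  unfold cauchyDensity
  refine Continuous.div (by fun_prop) ?_ fun y => by positivity
  refine continuous_const.mul (Continuous.rpow_const (by fun_prop) fun y => Or.inl ?_)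
  positivity

theorem lintegral_rpow_mul_exp_neg_mul_Ioi {a r : ℝ} (ha : 0 < a) (hr : 0 < r) :
    ∫⁻ t in Set.Ioi (0 : ℝ), ENNReal.ofReal (t ^ (a - 1) * Real.exp (-(r * t))) =
      ENNReal.ofReal ((1 / r) ^ a * Real.Gamma a) := by
  have hG := Real.Gamma_pos_of_pos ha
  rw [← Real.integral_rpow_mul_exp_neg_mul_Ioi ha hr, ofReal_integral_eq_lintegral_ofReal]
  · refine Integrable.of_integral_ne_zero ?_
    rw [Real.integral_rpow_mul_exp_neg_mul_Ioi ha hr]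
    positivity
  · filter_upwards [ae_restrict_mem measurableSet_Ioi] with t ht
    have : 0 < t := ht
    positivity

theorem integrable_rexp_neg_mul_sq_norm (n : ℕ) {b : ℝ} (hb : 0 < b) :
    Integrable fun y : EuclideanSpace ℝ (Fin n) => Real.exp (-b * ‖y‖ ^ 2) := by
  refine Integrable.of_integral_ne_zero ?_
  rw [GaussianFourier.integral_rexp_neg_mul_sq_norm hb]
  positivity

theorem lintegral_rexp_neg_mul_sq_norm (n : ℕ) {b : ℝ} (hb : 0 < b) :
    ∫⁻ y : EuclideanSpace ℝ (Fin n), ENNReal.ofReal (Real.exp (-b * ‖y‖ ^ 2)) =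
      ENNReal.ofReal ((Real.pi / b) ^ ((n : ℝ) / 2)) := by
  rw [← ofReal_integral_eq_lintegral_ofReal (integrable_rexp_neg_mul_sq_norm n hb)
    (ae_of_all _ fun y => (Real.exp_pos _).le), GaussianFourier.integral_rexp_neg_mul_sq_norm hb]
  simp

theorem integrable_gaussianDensity (n : ℕ) {σ : ℝ} (hσ : 0 < σ) :
    Integrable (gaussianDensity n σ) := by
  have : gaussianDensity n σ = fun y => (√(2 * Real.pi * σ ^ 2))⁻¹ ^ n *
      Real.exp (-(1 / (2 * σ ^ 2)) * ‖y‖ ^ 2) := by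
    ext y
    rw [gaussianDensity_eq_profile, gaussianProfile]
    congr 2
    ring
  rw [this]
  exact (integrable_rexp_neg_mul_sq_norm n (by positivity)).const_mul _

/-- The Cauchy law is a Gamma mixture of Gaussians: the power of 1 + ‖y‖²/γ² is a Gamma integral
over t of exponentials. Integrating in y first (Tonelli) produces t^(-n/2), which leaves
t^(-1/2)e^(-t) in every dimension, with integral Γ(1/2) = √π. -/
theorem lintegral_cauchyDensity (n : ℕ) {γ : ℝ} (hγ : 0 < γ) :
    ∫⁻ y, ENNReal.ofReal (cauchyDensity n γ y) = 1 := by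
  have hπ := Real.pi_pos
  set a : ℝ := ((n : ℝ) + 1) / 2 with ha_def
  have ha : 0 < a := by positivity
  set k : ℝ := (Real.pi ^ a * γ ^ n)⁻¹ with hk_def
  have hk : 0 < k := by positivity
  have hmix : ∀ y : EuclideanSpace ℝ (Fin n), ENNReal.ofReal (cauchyDensity n γ y) =
      ENNReal.ofReal k * ∫⁻ t in Set.Ioi (0 : ℝ),
        ENNReal.ofReal (t ^ (a - 1) * Real.exp (-((1 + ‖y‖ ^ 2 / γ ^ 2) * t))) := fun y => by
    rw [lintegral_rpow_mul_exp_neg_mul_Ioi ha (by positivity), ← ENNReal.ofReal_mul hk.le]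
    congr 1
    rw [cauchyDensity, one_div, Real.inv_rpow (by positivity)]
    simp only [hk_def, ← ha_def]
    field_simp
  simp_rw [hmix]
  rw [lintegral_const_mul' _ _ ENNReal.ofReal_ne_top, lintegral_lintegral_swap]
  · have hinner : ∀ t ∈ Set.Ioi (0 : ℝ), ∫⁻ y : EuclideanSpace ℝ (Fin n),
        ENNReal.ofReal (t ^ (a - 1) * Real.exp (-((1 + ‖y‖ ^ 2 / γ ^ 2) * t))) =
        ENNReal.ofReal ((Real.pi * γ ^ 2) ^ ((n : ℝ) / 2)) *
          ENNReal.ofReal (t ^ ((1 / 2 : ℝ) - 1) * Real.exp (-(1 * t))) := fun t ht => by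
      have ht : 0 < t := ht
      have : ∀ y : EuclideanSpace ℝ (Fin n),
          ENNReal.ofReal (t ^ (a - 1) * Real.exp (-((1 + ‖y‖ ^ 2 / γ ^ 2) * t))) =
          ENNReal.ofReal (t ^ (a - 1) * Real.exp (-t)) *
            ENNReal.ofReal (Real.exp (-(t / γ ^ 2) * ‖y‖ ^ 2)) := fun y => by
        rw [← ENNReal.ofReal_mul (by positivity), mul_assoc, ← Real.exp_add]
        congr 3
        ring
      simp_rw [this]
      rw [lintegral_const_mul' _ _ ENNReal.ofReal_ne_top,
        lintegral_rexp_neg_mul_sq_norm n (by positivity), ← ENNReal.ofReal_mul (by positivity),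
        ← ENNReal.ofReal_mul (by positivity)]
      congr 1
      have h1 : Real.pi / (t / γ ^ 2) = (Real.pi * γ ^ 2) * t⁻¹ := by field_simp
      have h2 : t ^ (a - 1) * t ^ (-((n : ℝ) / 2)) = t ^ ((1 / 2 : ℝ) - 1) := by
        rw [← Real.rpow_add ht]
        congr 1
        rw [ha_def]; ring
      rw [h1, Real.mul_rpow (by positivity) (by positivity), Real.inv_rpow ht.le,
        ← Real.rpow_neg ht.le, ← h2, one_mul]
      ring
    rw [setLIntegral_congr_fun measurableSet_Ioi hinner,
      lintegral_const_mul' _ _ ENNReal.ofReal_ne_top,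
      lintegral_rpow_mul_exp_neg_mul_Ioi (by norm_num) one_pos,
      ← ENNReal.ofReal_mul (by positivity), ← ENNReal.ofReal_mul hk.le, ← ENNReal.ofReal_one]
    congr 1
    rw [Real.Gamma_one_half_eq, Real.mul_rpow hπ.le (by positivity), ← Real.rpow_natCast γ 2,
      ← Real.rpow_mul hγ.le, hk_def, Real.sqrt_eq_rpow]
    have h1 : ((2 : ℕ) : ℝ) * ((n : ℝ) / 2) = n := by push_cast; ring
    have h2 : Real.pi ^ a = Real.pi ^ ((n : ℝ) / 2) * Real.pi ^ (1 / 2 : ℝ) := by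
      rw [← Real.rpow_add hπ]; congr 1; rw [ha_def]; ring
    rw [h1, Real.rpow_natCast, h2, div_one, Real.one_rpow]
    field_simp
  · refine Measurable.aemeasurable ?_
    unfold Function.uncurry
    fun_prop

theorem integrable_cauchyDensity (n : ℕ) {γ : ℝ} (hγ : 0 < γ) :
    Integrable (cauchyDensity n γ) := by
  refine ⟨(continuous_cauchyDensity n hγ).aestronglyMeasurable, ?_⟩
  rw [hasFiniteIntegral_iff_ofReal (ae_of_all _ (cauchyDensity_nonneg n hγ)),
    lintegral_cauchyDensity n hγ]
  exact ENNReal.one_lt_top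

/-! ### Error probabilities as integrals and optimality of the MAP rule -/

theorem real_withDensity_eq_setIntegral {α : Type*} [MeasurableSpace α] {μ : Measure α}
    {f : α → ℝ} (hf : Integrable f μ) (h0 : ∀ x, 0 ≤ f x) {s : Set α} (hs : MeasurableSet s) :
    (μ.withDensity fun x => ENNReal.ofReal (f x)).real s = ∫ x in s, f x ∂μ := by
  rw [measureReal_def, withDensity_apply _ hs,
    integral_eq_lintegral_of_nonneg_ae (ae_of_all _ h0) hf.aestronglyMeasurable.restrict]

theorem falseAlarm_eq_setIntegral (n : ℕ) {σ : ℝ} (hσ : 0 < σ)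
    {A : Set (EuclideanSpace ℝ (Fin n))} (hA : MeasurableSet A) :
    falseAlarm n σ A = ∫ y in Aᶜ, gaussianDensity n σ y :=
  real_withDensity_eq_setIntegral (integrable_gaussianDensity n hσ) (gaussianDensity_nonneg n σ)
    hA.compl

theorem detection_eq_setIntegral (n : ℕ) {γ : ℝ} (hγ : 0 < γ)
    {A : Set (EuclideanSpace ℝ (Fin n))} (hA : MeasurableSet A) :
    detection n γ A = ∫ y in Aᶜ, cauchyDensity n γ y :=
  real_withDensity_eq_setIntegral (integrable_cauchyDensity n hγ) (cauchyDensity_nonneg n hγ)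
    hA.compl

theorem one_sub_detection_eq_setIntegral (n : ℕ) {γ : ℝ} (hγ : 0 < γ)
    {A : Set (EuclideanSpace ℝ (Fin n))} (hA : MeasurableSet A) :
    1 - detection n γ A = ∫ y in A, cauchyDensity n γ y := by
  have h := integral_add_compl hA (integrable_cauchyDensity n hγ)
  have h1 : ∫ y, cauchyDensity n γ y = 1 := by
    rw [integral_eq_lintegral_of_nonneg_ae (ae_of_all _ (cauchyDensity_nonneg n hγ))
      (integrable_cauchyDensity n hγ).aestronglyMeasurable, lintegral_cauchyDensity n hγ]
    simp
  rw [detection_eq_setIntegral n hγ hA]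
  linarith

theorem measurableSet_mapRegion (n : ℕ) (σ : ℝ) {γ : ℝ} (hγ : 0 < γ) (priorG priorC : ℝ) :
    MeasurableSet (mapRegion n σ γ priorG priorC) :=
  (isClosed_le (continuous_const.mul (continuous_cauchyDensity n hγ))
    (continuous_const.mul (continuous_gaussianDensity n σ))).measurableSet

theorem errorProb_eq_setIntegral (n : ℕ) {σ γ : ℝ} (hσ : 0 < σ) (hγ : 0 < γ) (priorG priorC : ℝ)
    {A : Set (EuclideanSpace ℝ (Fin n))} (hA : MeasurableSet A) :
    errorProb n σ γ priorG priorC A = priorC +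
      ∫ y in Aᶜ, (priorG * gaussianDensity n σ y - priorC * cauchyDensity n γ y) := by
  rw [errorProb, falseAlarm_eq_setIntegral n hσ hA, detection_eq_setIntegral n hγ hA,
    integral_sub, integral_const_mul, integral_const_mul]
  · ring
  · exact ((integrable_gaussianDensity n hσ).const_mul _).integrableOn
  · exact ((integrable_cauchyDensity n hγ).const_mul _).integrableOn

/-- Up to a constant the error is the integral of a fixed function w over the rejection set, and
this is least when the set collects exactly the points where w is negative. -/
theorem errorProb_mapRegion_le (n : ℕ) {σ γ : ℝ} (hσ : 0 < σ) (hγ : 0 < γ) (priorG priorC : ℝ)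
    {A : Set (EuclideanSpace ℝ (Fin n))} (hA : MeasurableSet A) :
    errorProb n σ γ priorG priorC (mapRegion n σ γ priorG priorC) ≤
      errorProb n σ γ priorG priorC A := by
  rw [errorProb_eq_setIntegral n hσ hγ _ _ (measurableSet_mapRegion n σ hγ _ _),
    errorProb_eq_setIntegral n hσ hγ _ _ hA]
  set w : EuclideanSpace ℝ (Fin n) → ℝ := fun y =>
    priorG * gaussianDensity n σ y - priorC * cauchyDensity n γ y with hw
  have hwc : Continuous w := (continuous_const.mul (continuous_gaussianDensity n σ)).sub
    (continuous_const.mul (continuous_cauchyDensity n hγ))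
  have hwi : Integrable w := ((integrable_gaussianDensity n hσ).const_mul _).sub
    ((integrable_cauchyDensity n hγ).const_mul _)
  have hset : (mapRegion n σ γ priorG priorC)ᶜ = {y | w y < 0} := by
    ext y
    simp [mapRegion, hw]
  -- Ties, where w = 0, do not affect the integral, so the strict and weak sign sets are
  -- interchangeable.
  rw [hset, setIntegral_neg_eq_setIntegral_nonpos hwi.1]
  exact add_le_add le_rfl (setIntegral_nonpos_le hA.compl hwc.stronglyMeasurable hwi)

/-! ### Reduction to one dimension -/

/-- Radial integrals in logarithmic squared-radius coordinates around the scale `s`. -/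
theorem integral_fun_norm_eq_integral_exp {n : ℕ} (hn : n ≠ 0) {s : ℝ} (hs : 0 < s) (f : ℝ → ℝ) :
    ∫ y : EuclideanSpace ℝ (Fin n), f ‖y‖ =
      ∫ v : ℝ, √Real.pi ^ n / Real.Gamma ((n : ℝ) / 2) *
        ((s * Real.exp (v / 2)) ^ n * f (s * Real.exp (v / 2))) := by
  have : Nonempty (Fin n) := ⟨⟨0, Nat.pos_of_ne_zero hn⟩⟩
  have hn' : (0 : ℝ) < n := by exact_mod_cast Nat.pos_of_ne_zero hn
  have hG := Real.Gamma_pos_of_pos (show 0 < (n : ℝ) / 2 by positivity)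
  have himg : (fun v : ℝ => s * Real.exp (v / 2)) '' Set.univ = Set.Ioi 0 := by
    ext r
    simp only [Set.image_univ, Set.mem_range, Set.mem_Ioi]
    constructor
    · rintro ⟨v, rfl⟩; positivity
    · intro hr
      refine ⟨2 * Real.log (r / s), ?_⟩
      rw [mul_div_cancel_left₀ _ two_ne_zero, Real.exp_log (by positivity)]
      field_simp
  have hsub := integral_image_eq_integral_abs_deriv_smul (s := Set.univ)
    (f := fun v : ℝ => s * Real.exp (v / 2)) (f' := fun v => s * (Real.exp (v / 2) * (1 / 2)))
    MeasurableSet.univ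
    (fun v _ => (((Real.hasDerivAt_exp _).comp v
      ((hasDerivAt_id v).div_const 2)).const_mul s).hasDerivWithinAt)
    (fun v _ w _ h => by
      have := Real.exp_injective (mul_left_cancel₀ hs.ne' h)
      linarith)
    (fun r => r ^ (n - 1) • f r)
  rw [integral_fun_norm_addHaar, ← himg, show Module.finrank ℝ (EuclideanSpace ℝ (Fin n)) = n by
    simp, hsub, setIntegral_univ, measureReal_def, EuclideanSpace.volume_ball, nsmul_eq_mul,
    smul_eq_mul, ← mul_assoc, ← integral_const_mul]
  congr 1
  ext v
  have hr : 0 < s * Real.exp (v / 2) := by positivity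
  rw [abs_of_pos (by positivity)]
  simp only [smul_eq_mul, Fintype.card_fin, ENNReal.ofReal_one, one_pow, one_mul]
  rw [ENNReal.toReal_ofReal (by positivity), Real.Gamma_add_one (by positivity)]
  obtain ⟨m, rfl⟩ := Nat.exists_eq_succ_of_ne_zero hn
  simp only [Nat.succ_eq_add_one, Nat.add_sub_cancel, pow_succ (s * Real.exp (v / 2)) m]
  field_simp

/-- Density of `log (‖Y‖² / (n σ²))` under the Gaussian hypothesis. -/
noncomputable def gaussianLogDensity (n : ℕ) (v : ℝ) : ℝ :=
  ((n : ℝ) / 2) ^ ((n : ℝ) / 2) * Real.exp (-((n : ℝ) / 2)) / Real.Gamma ((n : ℝ) / 2) *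
    Real.exp ((n : ℝ) / 2 * (v + 1 - Real.exp v))

/-- Density of `log (‖Y‖² / (n σ²))` under the Cauchy hypothesis, with `ρ = σ² / γ²`. -/
noncomputable def cauchyLogDensity (n : ℕ) (ρ v : ℝ) : ℝ :=
  Real.Gamma (((n : ℝ) + 1) / 2) / (Real.Gamma ((n : ℝ) / 2) * √Real.pi) *
    ((ρ * n * Real.exp v) ^ ((n : ℝ) / 2) /
      (1 + ρ * n * Real.exp v) ^ (((n : ℝ) + 1) / 2))

theorem sq_mul_exp_half {s v : ℝ} : (s * Real.exp (v / 2)) ^ 2 = s ^ 2 * Real.exp v := by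
  rw [mul_pow, ← Real.exp_nat_mul]
  congr 2
  push_cast
  ring

/-- The scale σ√n is the typical norm under the Gaussian hypothesis; choosing it removes σ and puts
the mode at v = 0. -/
theorem pow_mul_gaussianProfile {n : ℕ} (hn : n ≠ 0) {σ : ℝ} (hσ : 0 < σ) (v : ℝ) :
    √Real.pi ^ n / Real.Gamma ((n : ℝ) / 2) * ((σ * √n * Real.exp (v / 2)) ^ n *
      gaussianProfile n σ (σ * √n * Real.exp (v / 2))) = gaussianLogDensity n v := by
  have hn' : (0 : ℝ) < n := by exact_mod_cast Nat.pos_of_ne_zero hn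
  have hπ := Real.pi_pos
  have hroot : √Real.pi ^ n * (σ * √n) ^ n * (√(2 * Real.pi * σ ^ 2))⁻¹ ^ n =
      ((n : ℝ) / 2) ^ ((n : ℝ) / 2) := by
    rw [← mul_pow, ← mul_pow]
    have : √Real.pi * (σ * √n) * (√(2 * Real.pi * σ ^ 2))⁻¹ = √((n : ℝ) / 2) := by
      rw [Real.sqrt_mul (by positivity), Real.sqrt_mul zero_le_two, Real.sqrt_sq hσ.le,
        Real.sqrt_div hn'.le]
      field_simp
    rw [this, Real.sqrt_eq_rpow, ← Real.rpow_natCast, ← Real.rpow_mul (by positivity)]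
    congr 1
    ring
  have hexp : Real.exp (v / 2) ^ n *
      Real.exp (-(σ * √n * Real.exp (v / 2)) ^ 2 / (2 * σ ^ 2)) =
      Real.exp (-((n : ℝ) / 2)) * Real.exp ((n : ℝ) / 2 * (v + 1 - Real.exp v)) := by
    rw [sq_mul_exp_half, mul_pow, Real.sq_sqrt hn'.le, ← Real.exp_nat_mul, ← Real.exp_add,
      ← Real.exp_add]
    congr 1
    field_simp
    ring
  rw [gaussianLogDensity, gaussianProfile, ← hroot, mul_pow _ (Real.exp (v / 2))]
  linear_combination (√Real.pi ^ n / Real.Gamma ((n : ℝ) / 2) * (σ * √n) ^ n *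
    (√(2 * Real.pi * σ ^ 2))⁻¹ ^ n) * hexp

theorem pow_mul_cauchyProfile {n : ℕ} (hn : n ≠ 0) {σ γ : ℝ} (hσ : 0 < σ) (hγ : 0 < γ) (v : ℝ) :
    √Real.pi ^ n / Real.Gamma ((n : ℝ) / 2) * ((σ * √n * Real.exp (v / 2)) ^ n *
      cauchyProfile n γ (σ * √n * Real.exp (v / 2))) =
      cauchyLogDensity n (σ ^ 2 / γ ^ 2) v := by
  have hn' : (0 : ℝ) < n := by exact_mod_cast Nat.pos_of_ne_zero hn
  have hπ := Real.pi_pos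
  have hG := Real.Gamma_pos_of_pos (show 0 < (n : ℝ) / 2 by positivity)
  have hq : (σ * √n * Real.exp (v / 2)) ^ 2 / γ ^ 2 = σ ^ 2 / γ ^ 2 * n * Real.exp v := by
    rw [sq_mul_exp_half, mul_pow, Real.sq_sqrt hn'.le]
    ring
  have hqpow : (σ ^ 2 / γ ^ 2 * n * Real.exp v) ^ ((n : ℝ) / 2) =
      (σ * √n * Real.exp (v / 2)) ^ n / γ ^ n := by
    rw [← hq, ← div_pow, ← div_pow, ← Real.rpow_natCast _ 2, ← Real.rpow_mul (by positivity),
      ← Real.rpow_natCast _ n]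
    congr 1
    push_cast
    ring
  have hπpow : Real.pi ^ (((n : ℝ) + 1) / 2) = √Real.pi ^ n * √Real.pi := by
    rw [← pow_succ, Real.sqrt_eq_rpow, ← Real.rpow_natCast, ← Real.rpow_mul hπ.le]
    congr 1
    push_cast
    ring
  rw [cauchyLogDensity, cauchyProfile, hq, hqpow, hπpow]
  field_simp

/-- The set of values of `log (‖Y‖² / (n σ²))` for which the Gaussian hypothesis is chosen. -/
def logRegion (n : ℕ) (ρ η : ℝ) : Set ℝ :=
  {v | η * cauchyLogDensity n ρ v ≤ gaussianLogDensity n v}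

theorem mem_logRegion_iff {n : ℕ} (hn : n ≠ 0) {σ γ priorG priorC : ℝ} (hσ : 0 < σ) (hγ : 0 < γ)
    (hG : 0 < priorG) (v : ℝ) :
    v ∈ logRegion n (σ ^ 2 / γ ^ 2) (priorC / priorG) ↔
      priorC * cauchyProfile n γ (σ * √n * Real.exp (v / 2)) ≤
        priorG * gaussianProfile n σ (σ * √n * Real.exp (v / 2)) := by
  have hn' : (0 : ℝ) < n := by exact_mod_cast Nat.pos_of_ne_zero hn
  have hΓ := Real.Gamma_pos_of_pos (show 0 < (n : ℝ) / 2 by positivity)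
  have hπ := Real.pi_pos
  rw [logRegion, Set.mem_ofPred_eq, ← pow_mul_gaussianProfile hn hσ,
    ← pow_mul_cauchyProfile hn hσ hγ]
  have hk : 0 < √Real.pi ^ n / Real.Gamma ((n : ℝ) / 2) *
    (σ * √n * Real.exp (v / 2)) ^ n / priorG := by positivity
  rw [← mul_le_mul_iff_right₀ hk (b := priorC * _)]
  congr! 1 <;> field_simp

theorem setIntegral_fun_norm_eq {n : ℕ} (hn : n ≠ 0) {s : ℝ} (hs : 0 < s) (f : ℝ → ℝ)
    (p : ℝ → Prop) (hp : MeasurableSet {y : EuclideanSpace ℝ (Fin n) | p ‖y‖})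
    (hp' : MeasurableSet {v : ℝ | p (s * Real.exp (v / 2))}) :
    ∫ y in {y : EuclideanSpace ℝ (Fin n) | p ‖y‖}, f ‖y‖ =
      ∫ v in {v : ℝ | p (s * Real.exp (v / 2))}, √Real.pi ^ n / Real.Gamma ((n : ℝ) / 2) *
        ((s * Real.exp (v / 2)) ^ n * f (s * Real.exp (v / 2))) := by
  classical
  rw [← integral_indicator hp, ← integral_indicator hp']
  -- The indicator of a radial region is itself radial, so it is absorbed into the integrand.
  have := integral_fun_norm_eq_integral_exp hn hs ({r | p r}.indicator f)
  refine Eq.trans ?_ (this.trans ?_)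
  · rfl
  · congr 1
    ext v
    by_cases h : p (s * Real.exp (v / 2)) <;> simp [Set.indicator, h]

theorem continuous_gaussianLogDensity (n : ℕ) : Continuous (gaussianLogDensity n) := by
  unfold gaussianLogDensity
  fun_prop

theorem continuous_cauchyLogDensity (n : ℕ) {ρ : ℝ} (hρ : 0 < ρ) :
    Continuous (cauchyLogDensity n ρ) := by
  unfold cauchyLogDensity
  refine continuous_const.mul (Continuous.div ?_ ?_ fun v => by positivity)
  · exact Continuous.rpow_const (by fun_prop) fun v => Or.inr (by positivity)
  · exact Continuous.rpow_const (by fun_prop) fun v => Or.inl (by positivity)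

theorem isClosed_logRegion (n : ℕ) {ρ : ℝ} (hρ : 0 < ρ) (η : ℝ) : IsClosed (logRegion n ρ η) :=
  isClosed_le (continuous_const.mul (continuous_cauchyLogDensity n hρ))
    (continuous_gaussianLogDensity n)

theorem falseAlarm_mapRegion {n : ℕ} (hn : n ≠ 0) {σ γ priorG : ℝ} (hσ : 0 < σ)
    (hγ : 0 < γ) (hG : 0 < priorG) (priorC : ℝ) :
    falseAlarm n σ (mapRegion n σ γ priorG priorC) =
      ∫ v in (logRegion n (σ ^ 2 / γ ^ 2) (priorC / priorG))ᶜ, gaussianLogDensity n v := by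
  have hn' : (0 : ℝ) < n := by exact_mod_cast Nat.pos_of_ne_zero hn
  have hmeas := measurableSet_mapRegion n σ hγ priorG priorC
  have hset : {v : ℝ | ¬ priorC * cauchyProfile n γ (σ * √n * Real.exp (v / 2)) ≤
        priorG * gaussianProfile n σ (σ * √n * Real.exp (v / 2))} =
      (logRegion n (σ ^ 2 / γ ^ 2) (priorC / priorG))ᶜ := by
    ext v
    rw [Set.mem_compl_iff, mem_logRegion_iff hn hσ hγ hG, Set.mem_ofPred_eq]
  have hset' : (mapRegion n σ γ priorG priorC)ᶜ = {y | ¬ priorC * cauchyProfile n γ ‖y‖ ≤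
      priorG * gaussianProfile n σ ‖y‖} := by
    ext y
    simp [mapRegion, gaussianDensity_eq_profile, cauchyDensity_eq_profile]
  have key := setIntegral_fun_norm_eq hn (s := σ * √n) (by positivity) (gaussianProfile n σ)
    (fun r => ¬ priorC * cauchyProfile n γ r ≤ priorG * gaussianProfile n σ r)
    (hset' ▸ hmeas.compl)
    (hset ▸ (isClosed_logRegion n (by positivity) _).measurableSet.compl)
  rw [falseAlarm_eq_setIntegral n hσ hmeas, hset']
  simp_rw [gaussianDensity_eq_profile]
  rw [key, hset]
  simp_rw [pow_mul_gaussianProfile hn hσ]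

theorem one_sub_detection_mapRegion {n : ℕ} (hn : n ≠ 0) {σ γ priorG : ℝ} (hσ : 0 < σ)
    (hγ : 0 < γ) (hG : 0 < priorG) (priorC : ℝ) :
    1 - detection n γ (mapRegion n σ γ priorG priorC) =
      ∫ v in logRegion n (σ ^ 2 / γ ^ 2) (priorC / priorG),
        cauchyLogDensity n (σ ^ 2 / γ ^ 2) v := by
  have hn' : (0 : ℝ) < n := by exact_mod_cast Nat.pos_of_ne_zero hn
  have hmeas := measurableSet_mapRegion n σ hγ priorG priorC
  have hset : {v : ℝ | priorC * cauchyProfile n γ (σ * √n * Real.exp (v / 2)) ≤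
        priorG * gaussianProfile n σ (σ * √n * Real.exp (v / 2))} =
      logRegion n (σ ^ 2 / γ ^ 2) (priorC / priorG) := by
    ext v
    rw [mem_logRegion_iff hn hσ hγ hG, Set.mem_ofPred_eq]
  have hset' : mapRegion n σ γ priorG priorC = {y | priorC * cauchyProfile n γ ‖y‖ ≤
      priorG * gaussianProfile n σ ‖y‖} := by
    ext y
    simp [mapRegion, gaussianDensity_eq_profile, cauchyDensity_eq_profile]
  have key := setIntegral_fun_norm_eq hn (s := σ * √n) (by positivity) (cauchyProfile n γ)
    (fun r => priorC * cauchyProfile n γ r ≤ priorG * gaussianProfile n σ r)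
    (hset' ▸ hmeas) (hset ▸ (isClosed_logRegion n (by positivity) _).measurableSet)
  rw [one_sub_detection_eq_setIntegral n hγ hmeas, hset']
  simp_rw [cauchyDensity_eq_profile]
  rw [key, hset]
  simp_rw [pow_mul_cauchyProfile hn hσ hγ]

/-! ### Gamma function asymptotics and the two densities near v = 0 -/

open Topology

/-- Log-convexity of Γ at the midpoint of s and s + 1. -/
theorem Gamma_add_half_sq_le {s : ℝ} (hs : 0 < s) :
    Real.Gamma (s + 1 / 2) ^ 2 ≤ s * Real.Gamma s ^ 2 := by
  have h := Real.Gamma_mul_add_mul_le_rpow_Gamma_mul_rpow_Gamma hs (show 0 < s + 1 by positivity)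
    (show (0 : ℝ) < 1 / 2 by norm_num) (show (0 : ℝ) < 1 / 2 by norm_num) (by norm_num)
  rw [show 1 / 2 * s + 1 / 2 * (s + 1) = s + 1 / 2 by ring, ← Real.sqrt_eq_rpow,
    ← Real.sqrt_eq_rpow] at h
  have hG := Real.Gamma_pos_of_pos hs
  have hG1 := Real.Gamma_pos_of_pos (show 0 < s + 1 by positivity)
  have hG2 := Real.Gamma_pos_of_pos (show 0 < s + 1 / 2 by positivity)
  have := pow_le_pow_left₀ hG2.le h 2
  rw [mul_pow, Real.sq_sqrt hG.le, Real.sq_sqrt hG1.le, Real.Gamma_add_one hs.ne'] at this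
  linarith

/-- The midpoint bound at s = n/2 gives the upper estimate of the squared ratio, and at s = (n -
1)/2 the lower one; they differ by a relative 1/n. -/
theorem tendsto_Gamma_half_ratio :
    Tendsto (fun n : ℕ => Real.Gamma (((n : ℝ) + 1) / 2) / Real.Gamma ((n : ℝ) / 2) / √n) atTop
      (𝓝 (√2)⁻¹) := by
  have hsq : Tendsto (fun n : ℕ =>
      (Real.Gamma (((n : ℝ) + 1) / 2) / Real.Gamma ((n : ℝ) / 2)) ^ 2 / n) atTop (𝓝 2⁻¹) := by
    have hlow : Tendsto (fun n : ℕ => (2⁻¹ : ℝ) - 2⁻¹ * (n : ℝ)⁻¹) atTop (𝓝 2⁻¹) := by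
      simpa using (tendsto_inv_atTop_zero.comp tendsto_natCast_atTop_atTop).const_mul
        (2⁻¹ : ℝ) |>.const_sub (2⁻¹ : ℝ)
    refine tendsto_of_tendsto_of_tendsto_of_le_of_le' hlow tendsto_const_nhds ?_ ?_
    · filter_upwards [eventually_gt_atTop 1] with n hn
      have hn' : (1 : ℝ) < n := by exact_mod_cast hn
      have hx : 0 < ((n : ℝ) - 1) / 2 := by linarith
      have hG := Real.Gamma_pos_of_pos (show 0 < (n : ℝ) / 2 by positivity)
      have h := Gamma_add_half_sq_le hx
      have hG1 := Real.Gamma_add_one hx.ne'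
      rw [show ((n : ℝ) - 1) / 2 + 1 / 2 = n / 2 by ring] at h
      rw [show ((n : ℝ) - 1) / 2 + 1 = (n + 1) / 2 by ring] at hG1
      rw [hG1, div_pow, le_div_iff₀ (by positivity), le_div_iff₀ (by positivity)]
      have : (2⁻¹ - 2⁻¹ * (n : ℝ)⁻¹) * n = (n - 1) / 2 := by field_simp
      rw [this, mul_pow]
      nlinarith [h, hx]
    · filter_upwards [eventually_gt_atTop 0] with n hn
      have hn' : (0 : ℝ) < n := by exact_mod_cast hn
      have hG := Real.Gamma_pos_of_pos (show 0 < (n : ℝ) / 2 by positivity)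
      have h := Gamma_add_half_sq_le (show 0 < (n : ℝ) / 2 by positivity)
      rw [show (n : ℝ) / 2 + 1 / 2 = (n + 1) / 2 by ring] at h
      rw [div_pow, div_le_iff₀ hn', div_le_iff₀ (by positivity)]
      linarith
  have := (Real.continuous_sqrt.tendsto _).comp hsq
  rw [Real.sqrt_inv] at this
  refine this.congr' ?_
  filter_upwards [eventually_gt_atTop 0] with n hn
  have hn' : (0 : ℝ) < n := by exact_mod_cast hn
  have hG := Real.Gamma_pos_of_pos (show 0 < (n : ℝ) / 2 by positivity)
  have hG1 := Real.Gamma_pos_of_pos (show 0 < ((n : ℝ) + 1) / 2 by positivity)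
  rw [Function.comp_apply, Real.sqrt_div (by positivity), Real.sqrt_sq (by positivity)]

/-- Value of the Gaussian logarithmic density at its mode. -/
noncomputable def gaussianPeak (n : ℕ) : ℝ :=
  ((n : ℝ) / 2) ^ ((n : ℝ) / 2) * Real.exp (-((n : ℝ) / 2)) / Real.Gamma ((n : ℝ) / 2)

theorem gaussianLogDensity_eq (n : ℕ) (v : ℝ) :
    gaussianLogDensity n v =
      gaussianPeak n * Real.exp ((n : ℝ) / 2 * (v + 1 - Real.exp v)) := rfl

theorem gaussianPeak_pos {n : ℕ} (hn : 0 < n) : 0 < gaussianPeak n := by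
  have hn' : (0 : ℝ) < n := by exact_mod_cast hn
  have hG := Real.Gamma_pos_of_pos (show 0 < (n : ℝ) / 2 by positivity)
  unfold gaussianPeak
  positivity

/-- Squaring leaves Γ(n/2)², and one of its factors is traded for Γ((n+1)/2) through the half-step
ratio. Duplication then gives Γ(n), so Stirling for integer factorials covers both parities of n. -/
theorem tendsto_gaussianPeak_sq_div :
    Tendsto (fun n : ℕ => gaussianPeak n ^ 2 / n) atTop (𝓝 (4 * Real.pi)⁻¹) := by
  have hπ := Real.pi_pos
  have hst := Stirling.tendsto_stirlingSeq_sqrt_pi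
  have h := tendsto_Gamma_half_ratio.div
    (hst.const_mul (2 * √Real.pi * √2)) (by positivity)
  have hlim : (√2)⁻¹ / (2 * √Real.pi * √2 * √Real.pi) = (4 * Real.pi)⁻¹ := by
    have h1 : √Real.pi * √Real.pi = Real.pi := Real.mul_self_sqrt hπ.le
    have h2 : √2 * √2 = (2 : ℝ) := Real.mul_self_sqrt zero_le_two
    rw [inv_eq_one_div, div_div, inv_eq_one_div]
    congr 1
    linear_combination (2 * √2 * √2) * h1 + (2 * Real.pi) * h2
  rw [hlim] at h
  refine h.congr' ?_
  filter_upwards [eventually_gt_atTop 0] with n hn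
  have hn' : (0 : ℝ) < n := by exact_mod_cast hn
  have hG := Real.Gamma_pos_of_pos (show 0 < (n : ℝ) / 2 by positivity)
  have hG1 := Real.Gamma_pos_of_pos (show 0 < ((n : ℝ) + 1) / 2 by positivity)
  have hdup := Real.Gamma_mul_Gamma_add_half ((n : ℝ) / 2)
  rw [show (n : ℝ) / 2 + 1 / 2 = (n + 1) / 2 by ring,
    show 2 * ((n : ℝ) / 2) = n by ring] at hdup
  have hfac : ((n.factorial : ℕ) : ℝ) = n * Real.Gamma n := by
    rw [← Real.Gamma_add_one hn'.ne', Real.Gamma_nat_eq_factorial]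
  have hGn := Real.Gamma_pos_of_pos hn'
  have hpow : (((n : ℝ) / 2) ^ ((n : ℝ) / 2)) ^ 2 = (n : ℝ) ^ n / 2 ^ n := by
    rw [← Real.rpow_natCast _ 2, ← Real.rpow_mul (by positivity), ← div_pow,
      ← Real.rpow_natCast _ n]
    congr 1
    push_cast
    ring
  have hexp : Real.exp (-((n : ℝ) / 2)) ^ 2 = (Real.exp 1 ^ n)⁻¹ := by
    rw [← Real.exp_nat_mul, ← Real.exp_nat_mul, ← Real.exp_neg]
    congr 1
    push_cast
    ring
  have h2 : (2 : ℝ) ^ (1 - (n : ℝ)) = 2 / 2 ^ n := by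
    rw [Real.rpow_sub two_pos, Real.rpow_one, Real.rpow_natCast]
  have hsq : √(2 * (n : ℝ)) = √2 * √n := Real.sqrt_mul zero_le_two _
  simp only [Pi.div_apply]
  rw [gaussianPeak, Stirling.stirlingSeq, hfac, div_pow (n : ℝ) (Real.exp 1) n,
    div_pow _ (Real.Gamma _), mul_pow, hpow, hexp, hsq]
  rw [h2] at hdup
  field_simp at hdup ⊢
  linear_combination hdup

theorem tendsto_log_gaussianPeak_div :
    Tendsto (fun n : ℕ => Real.log (gaussianPeak n) / Real.log n) atTop (𝓝 2⁻¹) := by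
  have hπ := Real.pi_pos
  have hlog : Tendsto (fun n : ℕ => Real.log (n : ℝ)) atTop atTop :=
    Real.tendsto_log_atTop.comp tendsto_natCast_atTop_atTop
  have h1 := (tendsto_gaussianPeak_sq_div.log (by positivity)).div_atTop hlog
  have h2 := (h1.add_const 1).const_mul (2⁻¹ : ℝ)
  rw [zero_add, mul_one] at h2
  refine h2.congr' ?_
  filter_upwards [eventually_gt_atTop 1] with n hn
  have hn' : (1 : ℝ) < n := by exact_mod_cast hn
  have hl : 0 < Real.log n := Real.log_pos hn'
  have hK := gaussianPeak_pos (zero_lt_one.trans hn)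
  rw [Real.log_div (by positivity) (by positivity), Real.log_pow]
  push_cast
  field_simp
  ring

/-- Limit of the Cauchy logarithmic density near zero. -/
noncomputable def cauchyLimit (ρ : ℝ) : ℝ := (√(2 * Real.pi * ρ))⁻¹ * Real.exp (-(1 / (2 * ρ)))

theorem cauchyLimit_pos {ρ : ℝ} (hρ : 0 < ρ) : 0 < cauchyLimit ρ := by
  have hπ := Real.pi_pos
  unfold cauchyLimit
  positivity

/-- With q = ρne^v, the factor (q/(1+q))^(n/2) = (1 + 1/q)^(-n/2) tends to e^(-1/(2ρ)); the leftover
(1+q)^(-1/2) cancels the √n growth of the Gamma ratio. Allowing any null sequence v provides the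
uniformity needed at endpoints and mean-value points. -/
theorem tendsto_cauchyLogDensity {ρ : ℝ} (hρ : 0 < ρ) {v : ℕ → ℝ} (hv : Tendsto v atTop (𝓝 0)) :
    Tendsto (fun n => cauchyLogDensity n ρ (v n)) atTop (𝓝 (cauchyLimit ρ)) := by
  have hπ := Real.pi_pos
  have hexp : Tendsto (fun n => Real.exp (v n)) atTop (𝓝 1) := by
    simpa [Function.comp_def] using (Real.continuous_exp.tendsto 0).comp hv
  have hA : Tendsto (fun n : ℕ => (1 + (ρ * n * Real.exp (v n))⁻¹) ^ n) atTop
      (𝓝 (Real.exp ρ⁻¹)) := by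
    refine Real.tendsto_one_add_pow_exp_of_tendsto ?_
    have : Tendsto (fun n => (ρ * Real.exp (v n))⁻¹) atTop (𝓝 (ρ * 1)⁻¹) :=
      (hexp.const_mul ρ).inv₀ (by positivity)
    rw [mul_one] at this
    refine this.congr' ?_
    filter_upwards [eventually_gt_atTop 0] with n hn
    have hn' : (0 : ℝ) < n := by exact_mod_cast hn
    field_simp
  have hB : Tendsto (fun n : ℕ => (n : ℝ)⁻¹ + ρ * Real.exp (v n)) atTop (𝓝 ρ) := by
    simpa using (tendsto_inv_atTop_zero.comp tendsto_natCast_atTop_atTop).add (hexp.const_mul ρ)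
  have hA' := ((Real.continuous_sqrt.tendsto _).comp hA).inv₀ (by positivity)
  have hB' := ((Real.continuous_sqrt.tendsto _).comp hB).inv₀ (by positivity)
  have h := ((tendsto_Gamma_half_ratio.div_const √Real.pi).mul hA').mul hB'
  have hlim : (√2)⁻¹ / √Real.pi * (√(Real.exp ρ⁻¹))⁻¹ * (√ρ)⁻¹ = cauchyLimit ρ := by
    rw [cauchyLimit, Real.sqrt_mul (by positivity), Real.sqrt_mul zero_le_two, ← Real.exp_half,
      ← Real.exp_neg, show -(ρ⁻¹ / 2) = -(1 / (2 * ρ)) by field_simp]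
    field_simp
  rw [hlim] at h
  refine h.congr' ?_
  filter_upwards [eventually_gt_atTop 0] with n hn
  have hn' : (0 : ℝ) < n := by exact_mod_cast hn
  simp only [Function.comp_apply]
  set q := ρ * n * Real.exp (v n) with hq
  have hq0 : 0 < q := by positivity
  have h1 : (n : ℝ)⁻¹ + ρ * Real.exp (v n) = (1 + q) / n := by rw [hq]; field_simp
  have h2 : q ^ ((n : ℝ) / 2) = √(q ^ n) := by
    rw [Real.sqrt_eq_rpow, ← Real.rpow_natCast, ← Real.rpow_mul hq0.le]; congr 1; ring
  have h3 : (1 + q) ^ (((n : ℝ) + 1) / 2) = √((1 + q) ^ n) * √(1 + q) := by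
    rw [Real.sqrt_eq_rpow, Real.sqrt_eq_rpow, ← Real.rpow_natCast, ← Real.rpow_mul (by positivity),
      ← Real.rpow_add (by positivity)]
    congr 1; ring
  have h4 : √((1 + q⁻¹) ^ n) = √((1 + q) ^ n) / √(q ^ n) := by
    rw [← Real.sqrt_div (by positivity), ← div_pow]
    congr 2
    field_simp
    ring
  rw [cauchyLogDensity, ← hq, h1, h2, h3, h4, Real.sqrt_div (by positivity)]
  have : 0 < √(q ^ n) := by positivity
  have : 0 < √((1 + q) ^ n) := by positivity
  have : 0 < √(1 + q) := by positivity
  have : 0 < √(n : ℝ) := by positivity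
  field_simp

/-! ### Location of the acceptance interval -/

/-- Half-width of the acceptance interval, to first order. -/
noncomputable def logScale (n : ℕ) : ℝ := √(2 * Real.log n / n)

theorem logScale_pos {n : ℕ} (hn : 1 < n) : 0 < logScale n := by
  have hn' : (1 : ℝ) < n := by exact_mod_cast hn
  have := Real.log_pos hn'
  exact Real.sqrt_pos.2 (by positivity)

theorem sq_logScale (n : ℕ) : logScale n ^ 2 = 2 * Real.log n / n :=
  Real.sq_sqrt (div_nonneg (mul_nonneg zero_le_two (Real.log_natCast_nonneg n)) n.cast_nonneg)

theorem tendsto_logScale : Tendsto logScale atTop (𝓝 0) := by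
  have h : Tendsto (fun n : ℕ => 2 * (Real.log n / n)) atTop (𝓝 (2 * 0)) :=
    ((Real.isLittleO_log_id_atTop.tendsto_div_nhds_zero).comp
      tendsto_natCast_atTop_atTop).const_mul 2
  have := (Real.continuous_sqrt.tendsto _).comp h
  simp only [mul_zero, Real.sqrt_zero] at this
  refine this.congr fun n => ?_
  simp [logScale, mul_div_assoc]

theorem gaussianLogDensity_pos {n : ℕ} (hn : 0 < n) (v : ℝ) : 0 < gaussianLogDensity n v :=
  mul_pos (gaussianPeak_pos hn) (Real.exp_pos _)

theorem cauchyLogDensity_pos {n : ℕ} (hn : 0 < n) {ρ : ℝ} (hρ : 0 < ρ) (v : ℝ) :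
    0 < cauchyLogDensity n ρ v := by
  have hn' : (0 : ℝ) < n := by exact_mod_cast hn
  have hG := Real.Gamma_pos_of_pos (show 0 < (n : ℝ) / 2 by positivity)
  have hG1 := Real.Gamma_pos_of_pos (show 0 < ((n : ℝ) + 1) / 2 by positivity)
  have hπ := Real.pi_pos
  unfold cauchyLogDensity
  positivity

/-- The peak contributes (log n)/2, the quadratic term of the exponent -(θ²/2) log n, and the Cauchy
term stays bounded. The limit changes sign exactly at θ = ±1. -/
theorem tendsto_logLikelihood {ρ η : ℝ} (hρ : 0 < ρ) (hη : 0 < η) (θ : ℝ) :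
    Tendsto (fun n : ℕ => (Real.log (gaussianLogDensity n (θ * logScale n)) -
      Real.log (η * cauchyLogDensity n ρ (θ * logScale n))) / Real.log n) atTop
      (𝓝 ((1 - θ ^ 2) / 2)) := by
  have hlog : Tendsto (fun n : ℕ => Real.log (n : ℝ)) atTop atTop :=
    Real.tendsto_log_atTop.comp tendsto_natCast_atTop_atTop
  have hv : Tendsto (fun n => θ * logScale n) atTop (𝓝 0) := by
    simpa using tendsto_logScale.const_mul θ
  have hc := (((tendsto_cauchyLogDensity hρ hv).const_mul η).log
    (mul_pos hη (cauchyLimit_pos hρ)).ne').div_atTop hlog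
  have hψ : Tendsto (fun n : ℕ => (n : ℝ) / 2 *
      (θ * logScale n + 1 - Real.exp (θ * logScale n)) / Real.log n) atTop
      (𝓝 (-(θ ^ 2 / 2))) := by
    rw [tendsto_iff_norm_sub_tendsto_zero]
    have hb : Tendsto (fun n => θ ^ 2 * |θ * logScale n|) atTop (𝓝 0) := by
      simpa using hv.abs.const_mul (θ ^ 2)
    refine squeeze_zero' (Eventually.of_forall fun _ => norm_nonneg _) ?_ hb
    have hsmall : ∀ᶠ n in atTop, |θ * logScale n| ≤ 1 := by
      have := hv.abs
      rw [abs_zero] at this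
      exact this.eventually_le_const one_pos
    filter_upwards [hsmall, eventually_gt_atTop 1] with n hs hn
    have hn' : (1 : ℝ) < n := by exact_mod_cast hn
    have hl := Real.log_pos hn'
    have hsq : (θ * logScale n) ^ 2 = θ ^ 2 * (2 * Real.log n / n) := by
      rw [mul_pow, sq_logScale]
    set x := θ * logScale n with hx
    -- Third order is needed: the remainder is multiplied by n/(2 log n), and since x² = 2θ² log n /
    -- n the bound |x|³ leaves θ²|x|, which vanishes.
    have hE := Real.exp_bound hs (n := 3) (by norm_num)
    norm_num [Finset.sum_range_succ, Nat.factorial] at hE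
    have hrw : (n : ℝ) / 2 * (x + 1 - Real.exp x) / Real.log n - -(θ ^ 2 / 2) =
        -((n : ℝ) / (2 * Real.log n) * (Real.exp x - (1 + x + x ^ 2 / 2))) := by
      rw [hsq]
      field_simp
      ring
    rw [hrw, norm_neg, norm_mul, Real.norm_eq_abs, Real.norm_eq_abs,
      abs_of_pos (show 0 < (n : ℝ) / (2 * Real.log n) by positivity)]
    calc (n : ℝ) / (2 * Real.log n) * |Real.exp x - (1 + x + x ^ 2 / 2)|
        ≤ (n : ℝ) / (2 * Real.log n) * |x| ^ 3 := by
          gcongr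
          refine hE.trans ?_
          nlinarith [pow_nonneg (abs_nonneg x) 3]
      _ = (n : ℝ) / (2 * Real.log n) * (x ^ 2 * |x|) := by rw [← sq_abs x]; ring
      _ = θ ^ 2 * |x| := by rw [hsq]; field_simp
  have h := (tendsto_log_gaussianPeak_div.add hψ).sub hc
  rw [show (2⁻¹ : ℝ) + -(θ ^ 2 / 2) - 0 = (1 - θ ^ 2) / 2 by ring] at h
  refine h.congr' ?_
  filter_upwards [eventually_gt_atTop 0] with n hn
  rw [gaussianLogDensity_eq, Real.log_mul (gaussianPeak_pos hn).ne' (Real.exp_pos _).ne',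
    Real.log_exp]
  ring

theorem mem_logRegion_iff_log {n : ℕ} (hn : 0 < n) {ρ η : ℝ} (hρ : 0 < ρ) (hη : 0 < η) (v : ℝ) :
    v ∈ logRegion n ρ η ↔
      0 ≤ Real.log (gaussianLogDensity n v) - Real.log (η * cauchyLogDensity n ρ v) := by
  rw [sub_nonneg, Real.log_le_log_iff (mul_pos hη (cauchyLogDensity_pos hn hρ v))
    (gaussianLogDensity_pos hn v)]
  rfl

theorem eventually_mem_logRegion {ρ η θ : ℝ} (hρ : 0 < ρ) (hη : 0 < η) (hθ : θ ^ 2 < 1) :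
    ∀ᶠ n : ℕ in atTop, θ * logScale n ∈ logRegion n ρ η := by
  filter_upwards [(tendsto_logLikelihood hρ hη θ).eventually_const_lt
    (show 0 < (1 - θ ^ 2) / 2 by linarith), eventually_gt_atTop 1] with n h hn
  have hl := Real.log_pos (show (1 : ℝ) < n by exact_mod_cast hn)
  rw [mem_logRegion_iff_log (by omega) hρ hη]
  exact ((div_pos_iff_of_pos_right hl).1 h).le

theorem eventually_notMem_logRegion {ρ η θ : ℝ} (hρ : 0 < ρ) (hη : 0 < η) (hθ : 1 < θ ^ 2) :
    ∀ᶠ n : ℕ in atTop, θ * logScale n ∉ logRegion n ρ η := by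
  filter_upwards [(tendsto_logLikelihood hρ hη θ).eventually_lt_const
    (show (1 - θ ^ 2) / 2 < 0 by linarith), eventually_gt_atTop 1] with n h hn
  have hl := Real.log_pos (show (1 : ℝ) < n by exact_mod_cast hn)
  rw [mem_logRegion_iff_log (by omega) hρ hη, not_le]
  exact (div_lt_iff₀ hl).1 h |>.trans_eq (zero_mul _)

/-- The terms (n/2)v in the two log-densities cancel. In x = e^v what remains is a concave logarithm
minus a linear term, so the region is a superlevel set of a concave function pulled back along a
monotone map. -/
theorem ordConnected_logRegion {n : ℕ} (hn : 0 < n) {ρ η : ℝ} (hρ : 0 < ρ) (hη : 0 < η) :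
    (logRegion n ρ η).OrdConnected := by
  have hn' : (0 : ℝ) < n := by exact_mod_cast hn
  have hG := Real.Gamma_pos_of_pos (show 0 < (n : ℝ) / 2 by positivity)
  have hG1 := Real.Gamma_pos_of_pos (show 0 < ((n : ℝ) + 1) / 2 by positivity)
  have hπ := Real.pi_pos
  have hK := gaussianPeak_pos hn
  set F : ℝ → ℝ := fun x => ((n : ℝ) + 1) / 2 * Real.log (1 + ρ * n * x) - n / 2 * x with hF
  have hconc : ConcaveOn ℝ (Set.Ioi 0) F := by
    refine ⟨convex_Ioi 0, fun x hx y hy a b ha hb hab => ?_⟩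
    have hx : 0 < x := hx
    have hy : 0 < y := hy
    have h := strictConcaveOn_log_Ioi.concaveOn.2 (show 1 + ρ * n * x ∈ Set.Ioi 0 by
      simp only [Set.mem_Ioi]; positivity) (show 1 + ρ * n * y ∈ Set.Ioi 0 by
      simp only [Set.mem_Ioi]; positivity) ha hb hab
    simp only [smul_eq_mul, hF] at h ⊢
    rw [show a * (1 + ρ * n * x) + b * (1 + ρ * n * y) = 1 + ρ * n * (a * x + b * y) by
      linear_combination hab] at h
    have := mul_le_mul_of_nonneg_left h (show 0 ≤ ((n : ℝ) + 1) / 2 by positivity)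
    linarith
  set k : ℝ := Real.log (Real.Gamma (((n : ℝ) + 1) / 2) / (Real.Gamma ((n : ℝ) / 2) * √Real.pi))
    with hk
  have hlevel : logRegion n ρ η = Real.exp ⁻¹' {x ∈ Set.Ioi 0 | Real.log η + k +
      (n : ℝ) / 2 * Real.log (ρ * n) - Real.log (gaussianPeak n) - n / 2 ≤ F x} := by
    ext v
    rw [mem_logRegion_iff_log hn hρ hη, gaussianLogDensity_eq, cauchyLogDensity,
      Real.log_mul hK.ne' (Real.exp_pos _).ne', Real.log_exp, Real.log_mul (by positivity)
      (by positivity), Real.log_mul (by positivity) (by positivity),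
      Real.log_div (x := (ρ * n * Real.exp v) ^ ((n : ℝ) / 2)) (by positivity) (by positivity),
      Real.log_rpow (by positivity), Real.log_rpow (by positivity),
      Real.log_mul (x := ρ * n) (by positivity) (by positivity), Real.log_exp, ← hk]
    simp only [Set.mem_preimage, Set.mem_ofPred_eq, Set.mem_Ioi, Real.exp_pos, true_and, hF]
    constructor <;> intro h <;> linarith
  rw [hlevel]
  exact (hconc.convex_ge _).ordConnected.preimage_mono Real.exp_monotone

theorem eq_zero_of_nonneg_set_eq_Icc {f : ℝ → ℝ} (hf : Continuous f) {a b : ℝ} (hab : a ≤ b)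
    (h : {x | 0 ≤ f x} = Set.Icc a b) : f a = 0 ∧ f b = 0 := by
  have hmem : ∀ x, 0 ≤ f x ↔ x ∈ Set.Icc a b := fun x => by rw [← h]; rfl
  refine ⟨le_antisymm ?_ ((hmem a).2 ⟨le_rfl, hab⟩), le_antisymm ?_ ((hmem b).2 ⟨hab, le_rfl⟩)⟩
  · refine le_of_tendsto (hf.continuousWithinAt (s := Set.Iio a)) ?_
    filter_upwards [self_mem_nhdsWithin] with x hx
    exact (not_le.1 fun h0 => absurd ((hmem x).1 h0).1 (not_le.2 hx)).le
  · refine le_of_tendsto (hf.continuousWithinAt (s := Set.Ioi b)) ?_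
    filter_upwards [self_mem_nhdsWithin] with x hx
    exact (not_le.1 fun h0 => absurd ((hmem x).1 h0).2 (not_le.2 hx)).le

/-- An order-connected set that contains ±(1-ε)τ_n and misses ±(1+ε)τ_n cannot reach past the missed
points. Four pointwise tests thus locate both endpoints. -/
theorem eventually_logRegion_bounds {ρ η ε : ℝ} (hρ : 0 < ρ) (hη : 0 < η) (hε : 0 < ε)
    (hε1 : ε < 1) :
    ∀ᶠ n : ℕ in atTop,
      logRegion n ρ η = Set.Icc (sInf (logRegion n ρ η)) (sSup (logRegion n ρ η)) ∧
      -((1 + ε) * logScale n) ≤ sInf (logRegion n ρ η) ∧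
      sInf (logRegion n ρ η) ≤ -((1 - ε) * logScale n) ∧
      (1 - ε) * logScale n ≤ sSup (logRegion n ρ η) ∧
      sSup (logRegion n ρ η) ≤ (1 + ε) * logScale n := by
  filter_upwards [eventually_mem_logRegion hρ hη (θ := 1 - ε) (by nlinarith),
    eventually_mem_logRegion hρ hη (θ := -(1 - ε)) (by nlinarith),
    eventually_notMem_logRegion hρ hη (θ := 1 + ε) (by nlinarith),
    eventually_notMem_logRegion hρ hη (θ := -(1 + ε)) (by nlinarith),
    eventually_gt_atTop 1] with n h1 h2 h3 h4 hn
  have hτ := logScale_pos hn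
  have hoc := ordConnected_logRegion (zero_lt_one.trans hn) hρ hη
  rw [neg_mul] at h2 h4
  have hsub : logRegion n ρ η ⊆
      Set.Icc (-((1 + ε) * logScale n)) ((1 + ε) * logScale n) := by
    intro x hx
    constructor
    · by_contra! hlt
      exact h4 (hoc.out hx h2 ⟨hlt.le, by nlinarith⟩)
    · by_contra! hlt
      exact h3 (hoc.out h1 hx ⟨by nlinarith, hlt.le⟩)
  have hcpt : IsCompact (logRegion n ρ η) :=
    isCompact_Icc.of_isClosed_subset (isClosed_logRegion n hρ η) hsub
  have hne : (logRegion n ρ η).Nonempty := ⟨_, h1⟩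
  refine ⟨eq_Icc_of_connected_compact ⟨hne, hoc.isPreconnected⟩ hcpt, ?_, ?_, ?_, ?_⟩
  · exact le_csInf hne fun x hx => (hsub hx).1
  · exact csInf_le hcpt.bddBelow h2
  · exact le_csSup hcpt.bddAbove h1
  · exact csSup_le hne fun x hx => (hsub hx).2

theorem tendsto_div_logScale_of_bounds {x : ℕ → ℝ} (h : ∀ ε : ℝ, 0 < ε → ε < 1 →
    ∀ᶠ n in atTop, (1 - ε) * logScale n ≤ x n ∧ x n ≤ (1 + ε) * logScale n) :
    Tendsto (fun n => x n / logScale n) atTop (𝓝 1) := by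
  rw [Metric.tendsto_nhds]
  intro δ hδ
  have hε : 0 < min (δ / 2) (1 / 2) := by positivity
  filter_upwards [h _ hε (lt_of_le_of_lt (min_le_right _ _) (by norm_num)),
    eventually_gt_atTop 1] with n hx hn
  have hτ := logScale_pos hn
  have h1 := (le_div_iff₀ hτ).2 hx.1
  have h2 := (div_le_iff₀ hτ).2 hx.2
  have := min_le_left (δ / 2) (1 / 2)
  rw [Real.dist_eq, abs_lt]
  constructor <;> linarith

theorem exists_logRegion_endpoints {ρ η : ℝ} (hρ : 0 < ρ) (hη : 0 < η) :
    ∃ a b : ℕ → ℝ,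
      (∀ᶠ n in atTop, logRegion n ρ η = Set.Icc (-(a n)) (b n) ∧
        gaussianLogDensity n (-(a n)) = η * cauchyLogDensity n ρ (-(a n)) ∧
        gaussianLogDensity n (b n) = η * cauchyLogDensity n ρ (b n)) ∧
      Tendsto (fun n => a n / logScale n) atTop (𝓝 1) ∧
      Tendsto (fun n => b n / logScale n) atTop (𝓝 1) := by
  refine ⟨fun n => -sInf (logRegion n ρ η), fun n => sSup (logRegion n ρ η), ?_,
    tendsto_div_logScale_of_bounds fun ε h0 h1 => ?_,
    tendsto_div_logScale_of_bounds fun ε h0 h1 => ?_⟩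
  · filter_upwards [eventually_logRegion_bounds hρ hη (ε := 1 / 2) (by norm_num) (by norm_num),
      eventually_gt_atTop 1] with n h hn
    have hτ := logScale_pos hn
    obtain ⟨hI, -, h2, h3, -⟩ := h
    have hz := eq_zero_of_nonneg_set_eq_Icc
      (f := fun v => gaussianLogDensity n v - η * cauchyLogDensity n ρ v)
      ((continuous_gaussianLogDensity n).sub
        (continuous_const.mul (continuous_cauchyLogDensity n hρ)))
      (show sInf (logRegion n ρ η) ≤ sSup (logRegion n ρ η) by linarith)
      (by rw [← hI]; ext v; simp [logRegion])
    rw [neg_neg]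
    exact ⟨hI, by linarith [hz.1], by linarith [hz.2]⟩
  · filter_upwards [eventually_logRegion_bounds hρ hη h0 h1] with n h
    constructor <;> linarith [h.2.1, h.2.2.1]
  · filter_upwards [eventually_logRegion_bounds hρ hη h0 h1] with n h
    exact ⟨h.2.2.2.1, h.2.2.2.2⟩

theorem tendsto_zero_of_div_logScale {x : ℕ → ℝ} {l : ℝ}
    (h : Tendsto (fun n => x n / logScale n) atTop (𝓝 l)) : Tendsto x atTop (𝓝 0) := by
  have := h.mul tendsto_logScale
  rw [mul_zero] at this
  refine this.congr' ?_
  filter_upwards [eventually_gt_atTop 1] with n hn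
  rw [div_mul_cancel₀ _ (logScale_pos hn).ne']

/-! ### Missed detection: integral of the Cauchy density -/

theorem tendsto_setIntegral_cauchyLogDensity {ρ : ℝ} (hρ : 0 < ρ) {a b : ℕ → ℝ}
    (ha : Tendsto (fun n => a n / logScale n) atTop (𝓝 1))
    (hb : Tendsto (fun n => b n / logScale n) atTop (𝓝 1)) :
    Tendsto (fun n => (∫ v in Set.Icc (-(a n)) (b n), cauchyLogDensity n ρ v) / logScale n)
      atTop (𝓝 (2 * cauchyLimit ρ)) := by
  -- The mean value theorem replaces uniform convergence on the interval by convergence along one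
  -- sequence c. The guard lets c be chosen for every n; its value is irrelevant when the interval
  -- is empty.
  have hmvt : ∀ n, ∃ c, -(a n) ≤ b n → c ∈ Set.Icc (-(a n)) (b n) ∧
      ∫ v in Set.Icc (-(a n)) (b n), cauchyLogDensity n ρ v =
        cauchyLogDensity n ρ c * (b n + a n) := fun n => by
    by_cases hab : -(a n) ≤ b n
    · obtain ⟨c, hc, h⟩ := exists_eq_const_mul_setIntegral_of_nonneg (μ := volume)
        (f := cauchyLogDensity n ρ) (g := fun _ => (1 : ℝ))
        (isConnected_Icc hab) measurableSet_Icc (continuous_cauchyLogDensity n hρ).continuousOn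
        (continuous_const.integrableOn_Icc)
        (((continuous_cauchyLogDensity n hρ).mul continuous_const).integrableOn_Icc)
        (fun _ _ => zero_le_one)
      refine ⟨c, fun _ => ⟨hc, ?_⟩⟩
      simpa [Measure.real, sub_neg_eq_add,
        ENNReal.toReal_ofReal (show 0 ≤ b n + a n by linarith)] using h
    · exact ⟨0, fun h => absurd h hab⟩
  choose c hc using hmvt
  have hord : ∀ᶠ n in atTop, -(a n) ≤ b n := by
    filter_upwards [ha.eventually_const_lt zero_lt_one, hb.eventually_const_lt zero_lt_one,
      eventually_gt_atTop 1] with n h1 h2 hn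
    have hτ := logScale_pos hn
    linarith [(div_pos_iff_of_pos_right hτ).1 h1, (div_pos_iff_of_pos_right hτ).1 h2]
  have hc0 : Tendsto c atTop (𝓝 0) := by
    refine tendsto_of_tendsto_of_tendsto_of_le_of_le' (by simpa using
      (tendsto_zero_of_div_logScale ha).neg) (tendsto_zero_of_div_logScale hb) ?_ ?_
    · filter_upwards [hord] with n h using (hc n h).1.1
    · filter_upwards [hord] with n h using (hc n h).1.2
  have h := (tendsto_cauchyLogDensity hρ hc0).mul (hb.add ha)
  rw [show cauchyLimit ρ * (1 + 1) = 2 * cauchyLimit ρ by ring] at h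
  refine h.congr' ?_
  filter_upwards [hord] with n hn
  rw [(hc n hn).2]
  ring

/-! ### False alarm: exponential tails of the Gaussian density -/

section ExponentialTail

variable {h : ℝ → ℝ} {x G m : ℝ}

theorem integrableOn_Ioi_of_le_exp (hc : Continuous h) (h0 : ∀ v, 0 ≤ h v) (hm : 0 < m)
    (hle : ∀ v, x ≤ v → h v ≤ G * Real.exp (-m * (v - x))) : IntegrableOn h (Set.Ioi x) := by
  have hint : IntegrableOn (fun v => G * Real.exp (m * x) * Real.exp (-m * v)) (Set.Ioi x) :=
    (integrableOn_exp_mul_Ioi (by linarith) x).const_mul _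
  refine hint.mono' hc.aestronglyMeasurable.restrict ?_
  filter_upwards [ae_restrict_mem measurableSet_Ioi] with v hv
  rw [Real.norm_of_nonneg (h0 v), mul_assoc, ← Real.exp_add]
  refine (hle v (le_of_lt hv)).trans_eq ?_
  congr 2
  ring

theorem setIntegral_Ioi_le_of_le_exp (hc : Continuous h) (h0 : ∀ v, 0 ≤ h v) (hm : 0 < m)
    (hle : ∀ v, x ≤ v → h v ≤ G * Real.exp (-m * (v - x))) :
    ∫ v in Set.Ioi x, h v ≤ G / m := by
  have hint : IntegrableOn (fun v => G * Real.exp (m * x) * Real.exp (-m * v)) (Set.Ioi x) :=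
    (integrableOn_exp_mul_Ioi (by linarith) x).const_mul _
  calc ∫ v in Set.Ioi x, h v
      ≤ ∫ v in Set.Ioi x, G * Real.exp (m * x) * Real.exp (-m * v) := by
        refine setIntegral_mono_on (integrableOn_Ioi_of_le_exp hc h0 hm hle) hint
          measurableSet_Ioi fun v hv => ?_
        rw [mul_assoc, ← Real.exp_add]
        refine (hle v (le_of_lt hv)).trans_eq ?_
        congr 2
        ring
    _ = G / m := by
        have he : Real.exp (m * x) * Real.exp (-m * x) = 1 := by
          rw [← Real.exp_add, neg_mul, add_neg_cancel, Real.exp_zero]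
        rw [integral_const_mul, integral_exp_mul_Ioi (by linarith), neg_div_neg_eq]
        linear_combination (G / m) * he

/-- The exponential minorant is required only on a window of length δ, at the cost of the factor 1 -
e^(-mδ). -/
theorem le_setIntegral_Ioi_of_exp_le {δ : ℝ} (h0 : ∀ v, 0 ≤ h v)
    (hi : IntegrableOn h (Set.Ioi x)) (hm : 0 < m) (hδ : 0 ≤ δ)
    (hle : ∀ v, x ≤ v → v ≤ x + δ → G * Real.exp (-m * (v - x)) ≤ h v) :
    G * (1 - Real.exp (-(m * δ))) / m ≤ ∫ v in Set.Ioi x, h v := by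
  have hcont : Continuous fun v => G * Real.exp (-m * (v - x)) := by fun_prop
  have hftc : ∫ v in x..(x + δ), G * Real.exp (-m * (v - x)) =
      G * (1 - Real.exp (-(m * δ))) / m := by
    rw [intervalIntegral.integral_eq_sub_of_hasDerivAt
      (f := fun v => -(G / m) * Real.exp (-m * (v - x))) (fun v _ => ?_)
      (hcont.intervalIntegrable _ _)]
    · simp only [add_sub_cancel_left, sub_self, mul_zero, Real.exp_zero, neg_mul]
      ring
    · have := ((((hasDerivAt_id v).sub_const x).const_mul (-m)).exp).const_mul (-(G / m))
      refine this.congr_deriv ?_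
      have hmm : G / m * m = G := div_mul_cancel₀ G hm.ne'
      simp only [id]
      linear_combination Real.exp (-m * (v - x)) * hmm
  rw [← hftc, intervalIntegral.integral_of_le (by linarith)]
  calc ∫ v in Set.Ioc x (x + δ), G * Real.exp (-m * (v - x))
      ≤ ∫ v in Set.Ioc x (x + δ), h v :=
        setIntegral_mono_on (hcont.integrableOn_Ioc) (hi.mono_set Set.Ioc_subset_Ioi_self)
          measurableSet_Ioc fun v hv => hle v hv.1.le hv.2
    _ ≤ ∫ v in Set.Ioi x, h v :=
        setIntegral_mono_set hi (ae_of_all _ h0) Set.Ioc_subset_Ioi_self.eventuallyLE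

end ExponentialTail

/-- Minus the slope of the exponent of the reflected Gaussian logarithmic density. -/
noncomputable def tailRate (s : ℝ) (n : ℕ) (x : ℝ) : ℝ := (n : ℝ) / 2 * (s * (Real.exp (s * x) - 1))

theorem tailRate_pos {s : ℝ} (hs : s = 1 ∨ s = -1) {n : ℕ} (hn : 0 < n) {x : ℝ} (hx : 0 < x) :
    0 < tailRate s n x := by
  have hn' : (0 : ℝ) < n := by exact_mod_cast hn
  refine mul_pos (by positivity) ?_
  rcases hs with rfl | rfl
  · have := Real.one_lt_exp_iff.2 hx
    rw [one_mul, one_mul]; linarith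
  · have := Real.exp_lt_one_iff.2 (show -1 * x < 0 by linarith)
    linarith

/-- The difference quotient of e^(sy) at 0 tends to s, and s² = 1 makes both tails decay at the same
leading rate. -/
theorem tendsto_tailRate {s : ℝ} (hs : s = 1 ∨ s = -1) {x : ℕ → ℝ}
    (hx : Tendsto (fun n => x n / logScale n) atTop (𝓝 1)) :
    Tendsto (fun n => tailRate s n (x n) / (n * logScale n)) atTop (𝓝 2⁻¹) := by
  have hpos : ∀ᶠ n in atTop, 0 < x n := by
    filter_upwards [hx.eventually_const_lt zero_lt_one, eventually_gt_atTop 1] with n h hn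
    exact (div_pos_iff_of_pos_right (logScale_pos hn)).1 h
  have hs2 : s * s = 1 := by rcases hs with rfl | rfl <;> norm_num
  have hder : HasDerivAt (fun y => Real.exp (s * y)) s 0 := by
    simpa using ((hasDerivAt_id (0 : ℝ)).const_mul s).exp
  have hslope := (hasDerivAt_iff_tendsto_slope.1 hder).comp
    (tendsto_nhdsWithin_iff.2 ⟨tendsto_zero_of_div_logScale hx,
      hpos.mono fun n h => h.ne'⟩)
  have h := (hslope.const_mul (2⁻¹ * s)).mul hx
  rw [show 2⁻¹ * s * s * 1 = (2⁻¹ : ℝ) by linear_combination 2⁻¹ * hs2] at h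
  refine h.congr' ?_
  filter_upwards [hpos, eventually_gt_atTop 1] with n h hn
  have hτ := logScale_pos hn
  have hn' : (0 : ℝ) < n := by exact_mod_cast zero_lt_one.trans hn
  simp only [Function.comp_apply, slope_def_field, mul_zero, Real.exp_zero, sub_zero, tailRate]
  field_simp

theorem gaussianLogDensity_reflect_eq (n : ℕ) (s v x : ℝ) :
    gaussianLogDensity n (s * v) = gaussianLogDensity n (s * x) *
      Real.exp ((n : ℝ) / 2 * (s * (v - x) - (Real.exp (s * v) - Real.exp (s * x)))) := by
  rw [gaussianLogDensity_eq, gaussianLogDensity_eq, mul_assoc, ← Real.exp_add]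
  congr 2
  ring

/-- The exponent is concave, so it lies below its tangent at x. -/
theorem gaussianLogDensity_le_exp_tailRate {n : ℕ} (hn : 0 < n) (s v x : ℝ) :
    gaussianLogDensity n (s * v) ≤
      gaussianLogDensity n (s * x) * Real.exp (-tailRate s n x * (v - x)) := by
  rw [gaussianLogDensity_reflect_eq n s v x]
  refine mul_le_mul_of_nonneg_left (Real.exp_le_exp.2 ?_) (gaussianLogDensity_pos hn _).le
  have h := mul_le_mul_of_nonneg_left (Real.add_one_le_exp (s * (v - x))) (Real.exp_pos (s * x)).le
  rw [← Real.exp_add, show s * x + s * (v - x) = s * v by ring] at h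
  rw [tailRate, show -((n : ℝ) / 2 * (s * (Real.exp (s * x) - 1))) * (v - x) =
    (n : ℝ) / 2 * (s * (v - x) - s * Real.exp (s * x) * (v - x)) by ring]
  gcongr
  linarith

/-- By concavity the exponent falls fastest at the right end w, so the slope there bounds its
decrease on the whole of [x, w]. -/
theorem exp_tailRate_le_gaussianLogDensity {n : ℕ} (hn : 0 < n) {s : ℝ} (hs : s = 1 ∨ s = -1)
    {v x w : ℝ} (hxv : x ≤ v) (hvw : v ≤ w) :
    gaussianLogDensity n (s * x) * Real.exp (-tailRate s n w * (v - x)) ≤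
      gaussianLogDensity n (s * v) := by
  rw [gaussianLogDensity_reflect_eq n s v x]
  refine mul_le_mul_of_nonneg_left (Real.exp_le_exp.2 ?_) (gaussianLogDensity_pos hn _).le
  have h := mul_le_mul_of_nonneg_left (Real.add_one_le_exp (s * (x - v))) (Real.exp_pos (s * v)).le
  rw [← Real.exp_add, show s * v + s * (x - v) = s * x by ring] at h
  have hmono : s * Real.exp (s * v) ≤ s * Real.exp (s * w) := by
    rcases hs with rfl | rfl
    · simpa using hvw
    · simpa using hvw
  have hmul := mul_le_mul_of_nonneg_right hmono (sub_nonneg.2 hxv)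
  rw [tailRate, show -((n : ℝ) / 2 * (s * (Real.exp (s * w) - 1))) * (v - x) =
    (n : ℝ) / 2 * (s * (v - x) - s * Real.exp (s * w) * (v - x)) by ring]
  gcongr
  linarith

theorem continuous_gaussianLogDensity_reflect (n : ℕ) (s : ℝ) :
    Continuous fun v => gaussianLogDensity n (s * v) :=
  (continuous_gaussianLogDensity n).comp (continuous_const.mul continuous_id)

theorem integrableOn_gaussianLogDensity_reflect {n : ℕ} (hn : 0 < n) {s : ℝ}
    (hs : s = 1 ∨ s = -1) {x : ℝ} (hx : 0 < x) :
    IntegrableOn (fun v => gaussianLogDensity n (s * v)) (Set.Ioi x) :=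
  integrableOn_Ioi_of_le_exp (continuous_gaussianLogDensity_reflect n s)
    (fun _ => (gaussianLogDensity_pos hn _).le) (tailRate_pos hs hn hx)
    fun v _ => gaussianLogDensity_le_exp_tailRate hn s v x

theorem tendsto_gaussianLogDensity_tail {s : ℝ} (hs : s = 1 ∨ s = -1) {x : ℕ → ℝ} {L : ℝ}
    (hx : Tendsto (fun n => x n / logScale n) atTop (𝓝 1))
    (hL : Tendsto (fun n => gaussianLogDensity n (s * x n)) atTop (𝓝 L)) :
    Tendsto (fun n => (n * logScale n) * ∫ v in Set.Ioi (x n), gaussianLogDensity n (s * v))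
      atTop (𝓝 (2 * L)) := by
  have hpos : ∀ᶠ n in atTop, 0 < x n := by
    filter_upwards [hx.eventually_const_lt zero_lt_one, eventually_gt_atTop 1] with n h hn
    exact (div_pos_iff_of_pos_right (logScale_pos hn)).1 h
  have hlog : Tendsto (fun n : ℕ => √(2 * Real.log n)) atTop atTop :=
    Real.tendsto_sqrt_atTop.comp ((Real.tendsto_log_atTop.comp
      tendsto_natCast_atTop_atTop).const_mul_atTop two_pos)
  have hstep : ∀ n : ℕ, 1 < n → logScale n = √(2 * Real.log n) / √n := fun n hn => by
    rw [logScale, Real.sqrt_div' _ n.cast_nonneg]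
  -- The window 1/√n is short against τ_n, so the rate at its far end is asymptotically unchanged,
  -- yet long against the decay length: rate times window grows like √(2 log n)/2.
  have hy : Tendsto (fun n => (x n + (√(n : ℝ))⁻¹) / logScale n) atTop (𝓝 1) := by
    have := hx.add (tendsto_inv_atTop_zero.comp hlog)
    rw [add_zero] at this
    refine this.congr' ?_
    filter_upwards [eventually_gt_atTop 1] with n hn
    have hτ := logScale_pos hn
    have hn' : (0 : ℝ) < n := by exact_mod_cast zero_lt_one.trans hn
    have hsn : 0 < √(n : ℝ) := Real.sqrt_pos.2 hn'
    rw [hstep n hn] at hτ ⊢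
    have := (div_pos_iff_of_pos_right hsn).1 hτ
    simp only [Function.comp_apply]
    field_simp
  have hm := tendsto_tailRate hs hx
  have hM := tendsto_tailRate hs hy
  have hMδ : Tendsto (fun n : ℕ => tailRate s n (x n + (√(n : ℝ))⁻¹) * (√(n : ℝ))⁻¹)
      atTop atTop := by
    refine (hM.pos_mul_atTop (by norm_num) hlog).congr' ?_
    filter_upwards [eventually_gt_atTop 1] with n hn
    have hτ := logScale_pos hn
    have hn' : (0 : ℝ) < n := by exact_mod_cast zero_lt_one.trans hn
    have hsn : 0 < √(n : ℝ) := Real.sqrt_pos.2 hn'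
    rw [hstep n hn] at hτ ⊢
    have h0 := (div_pos_iff_of_pos_right hsn).1 hτ
    have hnn : √(n : ℝ) ^ 2 = n := Real.sq_sqrt hn'.le
    field_simp
    rw [hnn, mul_comm]
  have hexp := (Real.tendsto_exp_neg_atTop_nhds_zero.comp hMδ).const_sub 1
  have hupper := hL.div hm (by norm_num)
  have hlower := (hL.mul hexp).div hM (by norm_num)
  rw [show L / 2⁻¹ = 2 * L by ring] at hupper
  rw [show L * (1 - 0) / 2⁻¹ = 2 * L by ring] at hlower
  refine tendsto_of_tendsto_of_tendsto_of_le_of_le' hlower hupper ?_ ?_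
  · filter_upwards [hpos, eventually_gt_atTop 1] with n hxn hn
    have hτ := logScale_pos hn
    have hn0 := zero_lt_one.trans hn
    have hn' : (0 : ℝ) < n := by exact_mod_cast hn0
    have hδ : 0 < (√(n : ℝ))⁻¹ := by positivity
    have hM0 := tailRate_pos hs hn0 (add_pos hxn hδ)
    have := le_setIntegral_Ioi_of_exp_le (fun v => (gaussianLogDensity_pos hn0 (s * v)).le)
      (integrableOn_gaussianLogDensity_reflect hn0 hs hxn) hM0 hδ.le
      (fun v h1 h2 => exp_tailRate_le_gaussianLogDensity hn0 hs h1 h2)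
    refine le_trans (le_of_eq ?_) (mul_le_mul_of_nonneg_left this (by positivity))
    simp only [Pi.div_apply, Function.comp_apply]
    field_simp
  · filter_upwards [hpos, eventually_gt_atTop 1] with n hxn hn
    have hτ := logScale_pos hn
    have hn0 := zero_lt_one.trans hn
    have hn' : (0 : ℝ) < n := by exact_mod_cast hn0
    have hm0 := tailRate_pos hs hn0 hxn
    have := setIntegral_Ioi_le_of_le_exp (continuous_gaussianLogDensity_reflect n s)
      (fun v => (gaussianLogDensity_pos hn0 (s * v)).le) hm0
      (fun v _ => gaussianLogDensity_le_exp_tailRate hn0 s v (x n))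
    refine le_trans (mul_le_mul_of_nonneg_left this (by positivity)) (le_of_eq ?_)
    simp only [Pi.div_apply]
    field_simp

theorem setIntegral_compl_Icc_gaussianLogDensity {n : ℕ} (hn : 0 < n) {a b : ℝ} (ha : 0 < a)
    (hb : 0 < b) :
    ∫ v in (Set.Icc (-a) b)ᶜ, gaussianLogDensity n v =
      (∫ v in Set.Ioi a, gaussianLogDensity n (-1 * v)) +
        ∫ v in Set.Ioi b, gaussianLogDensity n (1 * v) := by
  have hset : (Set.Icc (-a) b)ᶜ = Set.Iio (-a) ∪ Set.Ioi b := by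
    ext v
    simp only [Set.mem_compl_iff, Set.mem_Icc, not_and_or, not_le, Set.mem_union, Set.mem_Iio,
      Set.mem_Ioi]
  have hright := integrableOn_gaussianLogDensity_reflect hn (s := 1) (Or.inl rfl) hb
  have hleft := integrableOn_gaussianLogDensity_reflect hn (s := -1) (Or.inr rfl) ha
  simp only [one_mul, neg_mul] at hright hleft ⊢
  have hleft' : IntegrableOn (gaussianLogDensity n) (Set.Iio (-a)) := by
    have := IntegrableOn.comp_neg_Iio (c := -a) (f := fun v => gaussianLogDensity n (-v))
      (by rwa [neg_neg])
    simpa only [neg_neg] using this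
  have hdisj : Disjoint (Set.Iio (-a)) (Set.Ioi b) := by
    rw [Set.disjoint_left]
    intro v h1 h2
    simp only [Set.mem_Iio, Set.mem_Ioi] at h1 h2
    linarith
  rw [hset, setIntegral_union hdisj measurableSet_Ioi hleft' hright,
    ← integral_Iic_eq_integral_Iio, integral_comp_neg_Ioi]

/-! ### Limits of the error probabilities and identification of the constant -/

theorem tendsto_one_sub_detection {σ γ priorG priorC : ℝ} (hσ : 0 < σ) (hγ : 0 < γ)
    (hG : 0 < priorG) (hC : 0 < priorC) :
    Tendsto (fun n : ℕ => (1 - detection n γ (mapRegion n σ γ priorG priorC)) / logScale n) atTop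
      (𝓝 (2 * cauchyLimit (σ ^ 2 / γ ^ 2))) := by
  have hρ : 0 < σ ^ 2 / γ ^ 2 := by positivity
  obtain ⟨a, b, hab, ha, hb⟩ := exists_logRegion_endpoints hρ (div_pos hC hG)
  refine (tendsto_setIntegral_cauchyLogDensity hρ ha hb).congr' ?_
  filter_upwards [hab, eventually_gt_atTop 0] with n h hn
  rw [one_sub_detection_mapRegion hn.ne' hσ hγ hG, h.1]

/-- Equality of the weighted densities at the endpoints transfers the Cauchy limit to the Gaussian
height there; each tail then contributes twice that height. -/
theorem tendsto_falseAlarm {σ γ priorG priorC : ℝ} (hσ : 0 < σ) (hγ : 0 < γ)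
    (hG : 0 < priorG) (hC : 0 < priorC) :
    Tendsto (fun n : ℕ => (n * logScale n) * falseAlarm n σ (mapRegion n σ γ priorG priorC)) atTop
      (𝓝 (4 * (priorC / priorG * cauchyLimit (σ ^ 2 / γ ^ 2)))) := by
  have hρ : 0 < σ ^ 2 / γ ^ 2 := by positivity
  obtain ⟨a, b, hab, ha, hb⟩ := exists_logRegion_endpoints hρ (div_pos hC hG)
  have ha0 : Tendsto (fun n => -(a n)) atTop (𝓝 0) := by
    simpa using (tendsto_zero_of_div_logScale ha).neg
  have hLa : Tendsto (fun n => gaussianLogDensity n (-1 * a n)) atTop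
      (𝓝 (priorC / priorG * cauchyLimit (σ ^ 2 / γ ^ 2))) := by
    refine ((tendsto_cauchyLogDensity hρ ha0).const_mul _).congr' ?_
    filter_upwards [hab] with n h
    rw [neg_one_mul, h.2.1]
  have hLb : Tendsto (fun n => gaussianLogDensity n (1 * b n)) atTop
      (𝓝 (priorC / priorG * cauchyLimit (σ ^ 2 / γ ^ 2))) := by
    refine ((tendsto_cauchyLogDensity hρ (tendsto_zero_of_div_logScale hb)).const_mul _).congr' ?_
    filter_upwards [hab] with n h
    rw [one_mul, h.2.2]
  have h := (tendsto_gaussianLogDensity_tail (Or.inr rfl) ha hLa).add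
    (tendsto_gaussianLogDensity_tail (Or.inl rfl) hb hLb)
  rw [← add_mul, show (2 + 2 : ℝ) = 4 by norm_num] at h
  refine h.congr' ?_
  filter_upwards [hab, eventually_gt_atTop 1, ha.eventually_const_lt zero_lt_one,
    hb.eventually_const_lt zero_lt_one] with n h hn h1 h2
  have hτ := logScale_pos hn
  rw [falseAlarm_mapRegion (by omega) hσ hγ hG, h.1, setIntegral_compl_Icc_gaussianLogDensity
    (by omega) ((div_pos_iff_of_pos_right hτ).1 h1) ((div_pos_iff_of_pos_right hτ).1 h2)]
  ring

theorem isEquivalent_of_tendsto_mul {u v w : ℕ → ℝ} {A : ℝ} (hA : A ≠ 0)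
    (hw : ∀ᶠ n in atTop, w n ≠ 0) (hu : Tendsto (fun n => w n * u n) atTop (𝓝 A))
    (hv : Tendsto (fun n => w n * v n) atTop (𝓝 A)) : u ~[atTop] v := by
  have h := hu.div hv hA
  rw [div_self hA] at h
  refine (isEquivalent_iff_tendsto_one ?_).2 (h.congr' ?_)
  · filter_upwards [hv.eventually_ne hA] with n hn
    exact right_ne_zero_of_mul hn
  · filter_upwards [hw] with n hn
    simp only [Pi.div_apply]
    exact mul_div_mul_left _ _ hn

theorem tendsto_log_const_mul_div_log {C : ℝ} (hC : 0 < C) :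
    Tendsto (fun n : ℕ => Real.log (C * n) / Real.log n) atTop (𝓝 1) := by
  have hlog : Tendsto (fun n : ℕ => Real.log (n : ℝ)) atTop atTop :=
    Real.tendsto_log_atTop.comp tendsto_natCast_atTop_atTop
  have h := ((tendsto_const_nhds (x := Real.log C)).div_atTop hlog).add_const 1
  rw [zero_add] at h
  refine h.congr' ?_
  filter_upwards [eventually_gt_atTop 1] with n hn
  have hn' : (1 : ℝ) < n := by exact_mod_cast hn
  have hl := Real.log_pos hn'
  rw [Real.log_mul hC.ne' (by positivity)]
  field_simp

theorem tendsto_sqrt_log_div_logScale {C : ℝ} (hC : 0 < C) :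
    Tendsto (fun n : ℕ => √(Real.log (C * n) / (C * n)) / logScale n) atTop
      (𝓝 (√(2 * C))⁻¹) := by
  have h := (Real.continuous_sqrt.tendsto _).comp
    ((tendsto_log_const_mul_div_log hC).mul_const (2 * C)⁻¹)
  rw [one_mul, Real.sqrt_inv] at h
  refine h.congr' ?_
  filter_upwards [eventually_gt_atTop 1] with n hn
  have hn' : (1 : ℝ) < n := by exact_mod_cast hn
  have hl := Real.log_pos hn'
  rw [logScale, ← Real.sqrt_div' _ (by positivity), Function.comp_apply]
  congr 1
  field_simp

theorem tendsto_logScale_mul_inv_sqrt {C : ℝ} (hC : 0 < C) :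
    Tendsto (fun n : ℕ => (n * logScale n) * (1 / √(C * n * Real.log (C * n)))) atTop
      (𝓝 √(2 / C)) := by
  have h := (Real.continuous_sqrt.tendsto _).comp
    (((tendsto_log_const_mul_div_log hC).inv₀ one_ne_zero).mul_const (2 / C))
  rw [inv_one, one_mul] at h
  refine h.congr' ?_
  have hCn : ∀ᶠ n : ℕ in atTop, 1 < C * (n : ℝ) :=
    (tendsto_natCast_atTop_atTop.const_mul_atTop hC).eventually_gt_atTop 1
  filter_upwards [eventually_gt_atTop 1, hCn] with n hn hCn
  have hn' : (1 : ℝ) < n := by exact_mod_cast hn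
  have hl := Real.log_pos hn'
  have hlC := Real.log_pos hCn
  rw [logScale, ← Real.sqrt_sq (show (0 : ℝ) ≤ n by positivity), ← Real.sqrt_mul (by positivity),
    Real.sqrt_sq (show (0 : ℝ) ≤ n by positivity), mul_one_div, ← Real.sqrt_div (by positivity),
    Function.comp_apply]
  congr 1
  field_simp

/-- Since ξ² = 2ρ, the exponential in √C cancels the one in the Cauchy limit. This single identity
matches the constants of both error types. -/
theorem sqrt_mul_cauchyLimit {σ γ η ξ C : ℝ} (hσ : 0 < σ) (hγ : 0 < γ) (hη : 0 < η)
    (hξ : ξ = √2 * σ / γ) (hC : C = (ξ / (2 * η)) ^ 2 * Real.exp (2 / ξ ^ 2)) :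
    2 * √Real.pi * η * √C * cauchyLimit (σ ^ 2 / γ ^ 2) = 1 := by
  have hπ := Real.pi_pos
  have hξ0 : 0 < ξ := by rw [hξ]; positivity
  have hξ2 : ξ ^ 2 = 2 * (σ ^ 2 / γ ^ 2) := by
    rw [hξ, div_pow, mul_pow, Real.sq_sqrt zero_le_two, mul_div_assoc]
  have hsC : √C = ξ / (2 * η) * Real.exp (1 / ξ ^ 2) := by
    rw [hC, Real.sqrt_mul (sq_nonneg _), Real.sqrt_sq (by positivity), ← Real.exp_half]
    congr 2
    ring
  have hlim : cauchyLimit (σ ^ 2 / γ ^ 2) = (√Real.pi * ξ)⁻¹ * Real.exp (-(1 / ξ ^ 2)) := by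
    rw [cauchyLimit, show 2 * Real.pi * (σ ^ 2 / γ ^ 2) = Real.pi * ξ ^ 2 by rw [hξ2]; ring,
      Real.sqrt_mul hπ.le, Real.sqrt_sq hξ0.le, ← hξ2]
  rw [hsC, hlim, Real.exp_neg]
  field_simp

end CauchyTest

open CauchyTest in
theorem theorem1 (σ γ priorG priorC ξ η C : ℝ) (hσ : 0 < σ) (hγ : 0 < γ)
    (hG0 : 0 < priorG) (hG1 : priorG < 1) (hC : priorC = 1 - priorG)
    (hξ : ξ = Real.sqrt 2 * σ / γ) (hη : η = priorC / priorG)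
    (hC_def : C = (ξ / (2 * η)) ^ 2 * Real.exp (2 / ξ ^ 2)) :
    -- the MAP detector minimizes the Bayesian error probability
    (∀ (n : ℕ) (A : Set (EuclideanSpace ℝ (Fin n))), MeasurableSet A →
      CauchyTest.errorProb n σ γ priorG priorC (CauchyTest.mapRegion n σ γ priorG priorC) ≤
        CauchyTest.errorProb n σ γ priorG priorC A) ∧
    -- missed detection
    (fun n : ℕ => 1 - CauchyTest.detection n γ (CauchyTest.mapRegion n σ γ priorG priorC))
      ~[atTop] (fun n : ℕ => Real.sqrt (2 / Real.pi) * (1 / η) *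
        Real.sqrt (Real.log (C * n) / (C * n))) ∧
    -- false alarm
    (fun n : ℕ => CauchyTest.falseAlarm n σ (CauchyTest.mapRegion n σ γ priorG priorC))
      ~[atTop] (fun n : ℕ => Real.sqrt (2 / Real.pi) *
        (1 / Real.sqrt ((C * n) * Real.log (C * n)))) ∧
    -- Bayesian error
    (fun n : ℕ => CauchyTest.errorProb n σ γ priorG priorC
        (CauchyTest.mapRegion n σ γ priorG priorC))
      ~[atTop] (fun n : ℕ => Real.sqrt (2 / Real.pi) * (priorC / η) *
        Real.sqrt (Real.log (C * n) / (C * n))) ∧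
    -- the two error types decay at different rates
    (fun n : ℕ => CauchyTest.falseAlarm n σ (CauchyTest.mapRegion n σ γ priorG priorC))
      =o[atTop] (fun n : ℕ =>
        1 - CauchyTest.detection n γ (CauchyTest.mapRegion n σ γ priorG priorC)) := by
  have hπ := Real.pi_pos
  have hC0 : 0 < priorC := by linarith
  have hη0 : 0 < η := by rw [hη]; positivity
  have hξ0 : 0 < ξ := by rw [hξ]; positivity
  have hCpos : 0 < C := by rw [hC_def]; positivity
  have hlim := cauchyLimit_pos (show 0 < σ ^ 2 / γ ^ 2 by positivity)
  have hconst := sqrt_mul_cauchyLimit hσ hγ hη0 hξ hC_def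
  have hD := tendsto_one_sub_detection hσ hγ hG0 hC0
  have hF := tendsto_falseAlarm hσ hγ hG0 hC0
  rw [← hη] at hF
  set c := cauchyLimit (σ ^ 2 / γ ^ 2)
  have hsC : 0 < √C := Real.sqrt_pos.2 hCpos
  have hsπ : 0 < √Real.pi := Real.sqrt_pos.2 hπ
  have h22 : √(2 : ℝ) * √2 = 2 := Real.mul_self_sqrt zero_le_two
  have hmiss : (fun n : ℕ => 1 - detection n γ (mapRegion n σ γ priorG priorC)) ~[atTop]
      (fun n : ℕ => √(2 / Real.pi) * (1 / η) * √(Real.log (C * n) / (C * n))) := by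
    refine isEquivalent_of_tendsto_mul (w := fun n => (logScale n)⁻¹) (A := 2 * c)
      (by positivity) ?_ ?_ ?_
    · filter_upwards [eventually_gt_atTop 1] with n hn
      exact (inv_pos.2 (logScale_pos hn)).ne'
    · exact hD.congr fun n => div_eq_inv_mul _ _
    · have h := (tendsto_sqrt_log_div_logScale hCpos).const_mul (√(2 / Real.pi) * (1 / η))
      have hval : √(2 / Real.pi) * (1 / η) * (√(2 * C))⁻¹ = 2 * c := by
        rw [Real.sqrt_div zero_le_two, Real.sqrt_mul zero_le_two]
        field_simp
        linarith
      rw [hval] at h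
      exact h.congr fun n => by ring
  have hfalse : (fun n : ℕ => falseAlarm n σ (mapRegion n σ γ priorG priorC)) ~[atTop]
      (fun n : ℕ => √(2 / Real.pi) * (1 / √((C * n) * Real.log (C * n)))) := by
    refine isEquivalent_of_tendsto_mul (w := fun n => n * logScale n) (A := 4 * (η * c))
      (by positivity) ?_ hF ?_
    · filter_upwards [eventually_gt_atTop 1] with n hn
      have := logScale_pos hn
      have hn' : (0 : ℝ) < n := by exact_mod_cast zero_lt_one.trans hn
      positivity
    · have h := (tendsto_logScale_mul_inv_sqrt hCpos).const_mul √(2 / Real.pi)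
      have hval : √(2 / Real.pi) * √(2 / C) = 4 * (η * c) := by
        rw [Real.sqrt_div zero_le_two, Real.sqrt_div zero_le_two, div_mul_div_comm, h22]
        field_simp
        linarith
      rw [hval] at h
      exact h.congr fun n => by ring
  have hrate : (fun n : ℕ => falseAlarm n σ (mapRegion n σ γ priorG priorC)) =o[atTop]
      (fun n : ℕ => 1 - detection n γ (mapRegion n σ γ priorG priorC)) := by
    -- The false alarm scales as 1/(nτ_n) and the miss as τ_n, so their ratio is governed by
    -- 1/(nτ_n²), with nτ_n² = 2 log n.
    have hτ : Tendsto (fun n : ℕ => n * logScale n * logScale n) atTop atTop := by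
      have hlog : Tendsto (fun n : ℕ => 2 * Real.log (n : ℝ)) atTop atTop :=
        (Real.tendsto_log_atTop.comp tendsto_natCast_atTop_atTop).const_mul_atTop two_pos
      refine hlog.congr' ?_
      filter_upwards [eventually_gt_atTop 1] with n hn
      have hn' : (0 : ℝ) < n := by exact_mod_cast zero_lt_one.trans hn
      rw [mul_assoc, ← sq, sq_logScale]
      field_simp
    have h := (hF.div hD (by positivity)).div_atTop hτ
    refine (isLittleO_iff_tendsto' ?_).2 (h.congr' ?_)
    · filter_upwards [hD.eventually_ne (by positivity)] with n hn h0
      exact absurd (by rw [h0, zero_div]) hn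
    · filter_upwards [eventually_gt_atTop 1] with n hn
      have := logScale_pos hn
      have hn' : (0 : ℝ) < n := by exact_mod_cast zero_lt_one.trans hn
      simp only [Pi.div_apply]
      field_simp
  refine ⟨fun n A hA => errorProb_mapRegion_le n hσ hγ priorG priorC hA, hmiss, hfalse, ?_, hrate⟩
  have hmain := (IsEquivalent.refl (u := fun _ : ℕ => priorC) (l := atTop)).mul hmiss
  have hsmall : (fun n : ℕ => priorG * falseAlarm n σ (mapRegion n σ γ priorG priorC)) =o[atTop]
      (fun n : ℕ => priorC * (1 - detection n γ (mapRegion n σ γ priorG priorC))) :=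
    (hrate.const_mul_left priorG).const_mul_right hC0.ne'
  have hsum := (IsEquivalent.refl.add_isLittleO hsmall).trans hmain
  refine (hsum.congr_left ?_).congr_right ?_
  · exact Eventually.of_forall fun n => by
      simp only [Pi.add_apply, errorProb]
      ring
  · exact Eventually.of_forall fun n => by
      simp only [Pi.mul_apply]
      ring
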